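/- Let $m\ge 2$ and let $\Gamma\subset U(m)$ be a finite subgroup acting freely on $\mathbb C^m\setminus\{0\}$. Let $X_\Gamma$ be a connected complex manifold of dimension $m$ with a Kähler metric $h$ and Kähler form $\eta=i\sum h_{i\bar j}\,dz_i\wedge d\bar z_j$, and let $\pi:X_\Gamma\to\mathbb C^m/\Gamma$ be a resolution, i.e. a proper holomorphic map that restricts to a biholomorphism $X_\Gamma\setminus\pi^{-1}(0)\to(\mathbb C^m\setminus\{0\})/\Gamma$. Assume that $h$ is asymptotically locally Euclidean: there is $\tau>0$ such that, in the Euclidean coordinates $x$ of $\mathbb C^m\cong\mathbb R^{2m}$ near infinity, $$\frac{\partial^\alpha}{\partial x^\alpha}\Big((\pi_*h)_{i\bar j}-\tfrac12\delta_{ij}\Big)=\mathcal O\big(|x|^{-\tau-|\alpha|}\big)\quad (|x|\to\infty)$$ for all $i,j$ and every multi-index $\alpha$. Assume that $h$ is Ricci-flat, i.e. its Ricci form $\rho_\eta=-i\partial\bar\partial\log\det(h_{i\bar j})$ vanishes. Let $d\mu_\eta=\eta^{\wedge m}/m!$ be the volume form of $\eta$, let $d\mu_0$ be the Euclidean volume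 form of $\mathbb C^m$ (which descends to $(\mathbb C^m\setminus\{0\})/\Gamma$), and for $R>0$ let $X_{\Gamma,R}=\pi^{-1}(\{|x|\le R\}/\Gamma)$. Then $$d\mu_\eta=\pi^*d\mu_0\quad\text{on } X_\Gamma\setminus\pi^{-1}(0),$$ and for every $R>0$ $$\mathrm{Vol}_\eta(X_{\Gamma,R})=\int_{X_{\Gamma,R}}d\mu_\eta=\frac{|\mathbb S^{2m-1}|}{2m\,|\Gamma|}\,R^{2m},$$ where $|\mathbb S^{2m-1}|$ is the area of the unit sphere in $\mathbb C^m$. -/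

import Mathlib

open scoped Manifold ContDiff Topology
open MeasureTheory

noncomputable section

namespace ALEKahler

/-! ### Differential forms of top degree -/

/-- The form `θ^{∧m} / m!` of a real 2-form `θ` on a real vector space, evaluated on `2m` vectors
`v (k, a)`, `k < m`, `a < 2`, listed as `v (0,0), v (0,1), v (1,0), v (1,1), …`:
`(1 / (2^m m!)) ∑_σ sign σ ∏ₖ θ (v (σ (k,0)), v (σ (k,1)))`. -/
def topPower {V : Type*} [AddCommGroup V] [Module ℝ V] [TopologicalSpace V] (m : ℕ)
    (θ : V [⋀^Fin 2]→L[ℝ] ℝ) (v : Fin m × Fin 2 → V) : ℝ :=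
  (1 / (2 ^ m * (m.factorial : ℝ))) *
    ∑ σ : Equiv.Perm (Fin m × Fin 2),
      ((Equiv.Perm.sign σ : ℤ) : ℝ) * ∏ k : Fin m, θ ![v (σ (k, 0)), v (σ (k, 1))]

/-- The Euclidean volume form `dx₁ ∧ dy₁ ∧ ⋯ ∧ dx_m ∧ dy_m` of `ℂ^m` on `2m` vectors. -/
def euclideanVolumeForm (m : ℕ) (v : Fin m × Fin 2 → EuclideanSpace ℂ (Fin m)) : ℝ :=
  Matrix.det (Matrix.of fun a b : Fin m × Fin 2 =>
    if b.2 = 0 then (v a b.1).re else (v a b.1).im)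

/-- The real frame `∂/∂x₁, ∂/∂y₁, …, ∂/∂x_m, ∂/∂y_m` of `ℂ^m`. -/
def realFrame (m : ℕ) (a : Fin m × Fin 2) : EuclideanSpace ℂ (Fin m) :=
  if a.2 = 0 then EuclideanSpace.single a.1 1 else EuclideanSpace.single a.1 Complex.I

/-! ### Hermitian matrices, Ricci form -/

/-- The matrix `h_{i j̄}` of a `(1,1)`-form `θ = i ∑ h_{i j̄} dzᵢ ∧ dz̄ⱼ` on `ℂ^m`, namely
`h_{i j̄} = (θ(eᵢ, i eⱼ) - i θ(eᵢ, eⱼ)) / 2`. For the standard form `∑ dxₖ ∧ dyₖ` it is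
`δ_{ij} / 2`. -/
def hermitianMatrix {m : ℕ}
    (θ : EuclideanSpace ℂ (Fin m) [⋀^Fin 2]→L[ℝ] ℝ) : Matrix (Fin m) (Fin m) ℂ :=
  Matrix.of fun i j =>
    (1 / 2 : ℂ) *
      ((θ ![EuclideanSpace.single i 1, EuclideanSpace.single j Complex.I] : ℂ)
        - Complex.I * (θ ![EuclideanSpace.single i 1, EuclideanSpace.single j 1] : ℂ))

/-- `∂²u / ∂zᵢ ∂z̄ⱼ` at `y` for a real function `u` on `ℂ^m`, with `∂/∂z = (∂/∂x - i ∂/∂y) / 2` and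
`∂/∂z̄ = (∂/∂x + i ∂/∂y) / 2`. -/
def ddbar {m : ℕ} (u : EuclideanSpace ℂ (Fin m) → ℝ) (y : EuclideanSpace ℂ (Fin m))
    (i j : Fin m) : ℂ :=
  let D : EuclideanSpace ℂ (Fin m) → EuclideanSpace ℂ (Fin m) → ℝ :=
    fun a b => iteratedFDeriv ℝ 2 u y ![a, b]
  (1 / 4 : ℂ) *
    (((D (EuclideanSpace.single i 1) (EuclideanSpace.single j 1)
        + D (EuclideanSpace.single i Complex.I) (EuclideanSpace.single j Complex.I) : ℝ) : ℂ)
      + Complex.I *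
        ((D (EuclideanSpace.single i 1) (EuclideanSpace.single j Complex.I)
          - D (EuclideanSpace.single i Complex.I) (EuclideanSpace.single j 1) : ℝ) : ℂ))

section Kahler

variable {m : ℕ} {X : Type*} [TopologicalSpace X] [ChartedSpace (EuclideanSpace ℂ (Fin m)) X]

/-- Pull-back at `z` of a field of real 2-forms on the complex manifold `X` by a (holomorphic) map
`f` from `ℂ^m` to `X`. -/
def pullForm
    (form : ∀ p : X, TangentSpace 𝓘(ℂ, EuclideanSpace ℂ (Fin m)) p [⋀^Fin 2]→L[ℝ] ℝ)
    (f : EuclideanSpace ℂ (Fin m) → X) (z : EuclideanSpace ℂ (Fin m)) :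
    EuclideanSpace ℂ (Fin m) [⋀^Fin 2]→L[ℝ] ℝ :=
  (form (f z)).compContinuousLinearMap
    ((mfderiv 𝓘(ℂ, EuclideanSpace ℂ (Fin m)) 𝓘(ℂ, EuclideanSpace ℂ (Fin m)) f z).restrictScalars ℝ)

variable (m X) in
/-- A Kähler form `η` on a complex manifold `X` of complex dimension `m`: a smooth closed real 2-form
which is invariant under the complex structure `J` (multiplication by `i` on tangent vectors) and
such that `h(v, w) = η(v, J w)` is positive definite. So `h` is the Kähler metric, and `h` and `η`
determine each other. Smoothness and closedness are read in the holomorphic charts. -/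
structure KahlerForm where
  /-- The 2-form. -/
  form : ∀ p : X, TangentSpace 𝓘(ℂ, EuclideanSpace ℂ (Fin m)) p [⋀^Fin 2]→L[ℝ] ℝ
  smooth : ∀ e ∈ atlas (EuclideanSpace ℂ (Fin m)) X,
    ContDiffOn ℝ ∞ (pullForm form e.symm) e.target
  closed : ∀ e ∈ atlas (EuclideanSpace ℂ (Fin m)) X, ∀ y ∈ e.target,
    extDeriv (pullForm form e.symm) y = 0
  invariant : ∀ (p : X) (v w : TangentSpace 𝓘(ℂ, EuclideanSpace ℂ (Fin m)) p),
    form p ![Complex.I • v, Complex.I • w] = form p ![v, w]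
  positive : ∀ (p : X) (v : TangentSpace 𝓘(ℂ, EuclideanSpace ℂ (Fin m)) p),
    v ≠ 0 → 0 < form p ![v, Complex.I • v]

namespace KahlerForm

/-- The components `ρ_{i j̄} = - ∂ᵢ ∂_j̄ log det (h_{k l̄})` of the Ricci form
`ρ_η = - i ∂∂̄ log det (h_{k l̄})` in the holomorphic chart `e`, at the point with coordinate `y`. -/
def ricci (η : KahlerForm m X) (e : OpenPartialHomeomorph X (EuclideanSpace ℂ (Fin m)))
    (y : EuclideanSpace ℂ (Fin m)) (i j : Fin m) : ℂ :=
  -ddbar (fun w => Real.log (hermitianMatrix (pullForm η.form e.symm w)).det.re) y i j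

/-- The Ricci form vanishes identically. -/
def RicciFlat (η : KahlerForm m X) : Prop :=
  ∀ e ∈ atlas (EuclideanSpace ℂ (Fin m)) X, ∀ y ∈ e.target, ∀ i j : Fin m, η.ricci e y i j = 0

/-- The volume form `dμ_η = η^{∧m} / m!` at `p`. -/
def volumeForm (η : KahlerForm m X) (p : X)
    (v : Fin m × Fin 2 → TangentSpace 𝓘(ℂ, EuclideanSpace ℂ (Fin m)) p) : ℝ :=
  topPower m (η.form p) v

variable [MeasurableSpace X]

/-- The measure defined by the volume form `dμ_η` on the domain of the chart `e` (and zero outside):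
its density with respect to Lebesgue measure in the coordinates `x₁, y₁, …, x_m, y_m` is the
coefficient of `dμ_η`, i.e. its value on the coordinate frame. -/
def chartMeasure (η : KahlerForm m X)
    (e : OpenPartialHomeomorph X (EuclideanSpace ℂ (Fin m))) : Measure X :=
  (((volume : Measure (EuclideanSpace ℂ (Fin m))).restrict e.target).withDensity fun y =>
    ENNReal.ofReal (topPower m (pullForm η.form e.symm y) (realFrame m))).map e.symm

/-- The measure of integration of `dμ_η` over `X`. The measures in the charts agree on overlaps, and
the measure on `X` obtained by patching them is the least one that dominates them all. -/
def volumeMeasure (η : KahlerForm m X) : Measure X :=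
  ⨆ e ∈ atlas (EuclideanSpace ℂ (Fin m)) X, η.chartMeasure e

end KahlerForm

end Kahler

/-! ### ALE Kähler resolutions -/

/-- The orbit relation on `ℂ^m` of a subgroup `Γ` of `U(m)`, the group of `ℂ`-linear isometries of
`ℂ^m`. -/
def orbitSetoid {m : ℕ}
    (Γ : Subgroup (EuclideanSpace ℂ (Fin m) ≃ₗᵢ[ℂ] EuclideanSpace ℂ (Fin m))) :
    Setoid (EuclideanSpace ℂ (Fin m)) where
  r z w := ∃ γ ∈ Γ, γ z = w
  iseqv :=
    { refl := fun z => ⟨1, Γ.one_mem, rfl⟩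
      symm := by
        rintro z _ ⟨γ, hγ, rfl⟩
        exact ⟨γ⁻¹, Γ.inv_mem hγ, γ.symm_apply_apply z⟩
      trans := by
        rintro z _ _ ⟨γ, hγ, rfl⟩ ⟨δ, hδ, rfl⟩
        exact ⟨δ * γ, Γ.mul_mem hδ hγ, rfl⟩ }

/-- The quotient `ℂ^m / Γ` for a subgroup `Γ` of `U(m)`, with the quotient topology. -/
abbrev QuotientSpace {m : ℕ}
    (Γ : Subgroup (EuclideanSpace ℂ (Fin m) ≃ₗᵢ[ℂ] EuclideanSpace ℂ (Fin m))) : Type :=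
  Quotient (orbitSetoid Γ)

/-- The projection `π_Γ : ℂ^m → ℂ^m / Γ`. -/
def proj {m : ℕ}
    (Γ : Subgroup (EuclideanSpace ℂ (Fin m) ≃ₗᵢ[ℂ] EuclideanSpace ℂ (Fin m)))
    (z : EuclideanSpace ℂ (Fin m)) : QuotientSpace Γ :=
  Quotient.mk (orbitSetoid Γ) z

/-- `Γ` acts freely on `ℂ^m` away from the origin. -/
def ActsFreely {m : ℕ}
    (Γ : Subgroup (EuclideanSpace ℂ (Fin m) ≃ₗᵢ[ℂ] EuclideanSpace ℂ (Fin m))) : Prop :=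
  ∀ γ ∈ Γ, ∀ z : EuclideanSpace ℂ (Fin m), z ≠ 0 → γ z = z → γ = 1

section Resolution

variable {m : ℕ}
  (Γ : Subgroup (EuclideanSpace ℂ (Fin m) ≃ₗᵢ[ℂ] EuclideanSpace ℂ (Fin m)))
  {X : Type*} [TopologicalSpace X] [ChartedSpace (EuclideanSpace ℂ (Fin m)) X]

/-- `f` is a holomorphic lift to `ℂ^m` of `π : X → ℂ^m / Γ` on the open set `U`. -/
def IsLocalLift (π : X → QuotientSpace Γ) (U : Set X) (f : X → EuclideanSpace ℂ (Fin m)) : Prop :=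
  IsOpen U ∧
    MDifferentiableOn 𝓘(ℂ, EuclideanSpace ℂ (Fin m)) 𝓘(ℂ, EuclideanSpace ℂ (Fin m)) f U ∧
    ∀ p ∈ U, proj Γ (f p) = π p

/-- The map `π⁻¹ ∘ π_Γ : ℂ^m → X`. It is used away from the origin, where `π` is invertible. -/
def inverseLift [Nonempty X] (π : X → QuotientSpace Γ) (z : EuclideanSpace ℂ (Fin m)) : X :=
  Function.invFun π (proj Γ z)

/-- `π : X → ℂ^m / Γ` is a resolution of the quotient singularity: a proper holomorphic map which is
a biholomorphism from `X ∖ π⁻¹(0)` onto `(ℂ^m ∖ {0}) / Γ`.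

Holomorphic functions on an open `V ⊆ ℂ^m / Γ` are the functions with holomorphic pull-back to
`π_Γ⁻¹(V)`, and `(ℂ^m ∖ {0}) / Γ` has local inverses of `π_Γ` as holomorphic charts. -/
structure IsResolution [Nonempty X] (π : X → QuotientSpace Γ) : Prop where
  proper : IsProperMap π
  /-- `π` is a holomorphic map of complex spaces. -/
  holomorphic : ∀ (V : Set (QuotientSpace Γ)) (g : QuotientSpace Γ → ℂ), IsOpen V →
    DifferentiableOn ℂ (g ∘ proj Γ) (proj Γ ⁻¹' V) →
    MDifferentiableOn 𝓘(ℂ, EuclideanSpace ℂ (Fin m)) 𝓘(ℂ, ℂ) (g ∘ π) (π ⁻¹' V)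
  /-- Off the exceptional set, `π` is holomorphic in the charts of `(ℂ^m ∖ {0}) / Γ`. -/
  exists_lift : ∀ p : X, π p ≠ proj Γ 0 → ∃ (U : Set X) (f : X → EuclideanSpace ℂ (Fin m)),
    p ∈ U ∧ IsLocalLift Γ π U f
  /-- Off the exceptional set, `π` is a bijection onto `(ℂ^m ∖ {0}) / Γ`. -/
  bijOn : Set.BijOn π (π ⁻¹' {proj Γ 0}ᶜ) {proj Γ 0}ᶜ
  /-- The inverse is holomorphic. -/
  holomorphic_inverse : MDifferentiableOn 𝓘(ℂ, EuclideanSpace ℂ (Fin m))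
    𝓘(ℂ, EuclideanSpace ℂ (Fin m)) (inverseLift Γ π) {0}ᶜ

/-- The metric is asymptotically locally Euclidean: for some `τ > 0`, in the Euclidean coordinates
at infinity, all derivatives of order `k` of `(π_* h)_{i j̄} - δ_{ij} / 2` are `O(|x|^{-τ-k})`, for
every `k`. -/
def IsALE [Nonempty X] (π : X → QuotientSpace Γ) (η : KahlerForm m X) : Prop :=
  ∃ τ : ℝ, 0 < τ ∧ ∀ (i j : Fin m) (k : ℕ),
    (fun x => iteratedFDeriv ℝ k
      (fun z => hermitianMatrix (pullForm η.form (inverseLift Γ π) z) i j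
        - (1 / 2 : ℂ) * (1 : Matrix (Fin m) (Fin m) ℂ) i j) x)
    =O[Bornology.cobounded (EuclideanSpace ℂ (Fin m))] fun x => ‖x‖ ^ (-τ - (k : ℝ))

/-- The truncated space `X_{Γ,R} = X ∖ {|x| > R}`, that is `π⁻¹` of the ball `{|x| ≤ R} / Γ`. -/
def truncation (π : X → QuotientSpace Γ) (R : ℝ) : Set X :=
  π ⁻¹' (proj Γ '' Metric.closedBall 0 R)

end Resolution

end ALEKahler

end

/-! Off the exceptional set the inverse of `π` lifts to a holomorphic map `φ = inverseLift` from
`ℂ^m ∖ {0}` to `X`. Everything rests on the claim that the coefficient of `φ^* dμ_η` with respect to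
`d μ_0` is identically `1` (`density_pullForm_inverseLift`).

This coefficient is `2^m det h`, where `h` is the Hermitian matrix of `φ^* η`
(`IsPositive.density_eq`). In a chart `e`, `log det h` is `2 log |det D(e ∘ φ)|` plus the Ricci
potential of `η` in `e`. The first term is the logarithm of the modulus of a nonvanishing
holomorphic function along each complex line, and the second is pluriharmonic because the Ricci form
vanishes. Hence `log det h` is harmonic along every complex line in `ℂ^m ∖ {0}`
(`harmonicAt_log_det_line`). Since `m ≥ 2`, each `z ≠ 0` lies on a full complex line that misses the
origin. On it `log det h` is harmonic on all of `ℂ` and tends to `log 2^(-m)` by the ALE condition,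
so Liouville's theorem makes it constant. No extension across the exceptional set is needed.

For the volume, `φ` is a `|Γ|`-to-one covering of the complement of the exceptional set, because `Γ`
acts freely, and it now respects volumes (`volume_preimage_inverseLift`). The exceptional set is
null: it lies in a level set of a nonconstant holomorphic function on the connected manifold `X`
(`volumeMeasure_exceptional`). So `|Γ|` times the volume of the truncation is the volume of a
Euclidean ball of radius `R`. -/

noncomputable section

namespace ALEKahler

/-! ### The volume form of a `(1,1)`-form -/

/-- The sign of the ordered pair `(a, b)` of elements of `Fin 2`, zero if they agree. -/
def pairSign (a b : Fin 2) : ℝ := if a = 0 ∧ b = 1 then 1 else if a = 1 ∧ b = 0 then -1 else 0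

lemma pairSign_perm (s : Equiv.Perm (Fin 2)) :
    pairSign (s 0) (s 1) = ((Equiv.Perm.sign s : ℤ) : ℝ) := by
  have h : ∀ s : Equiv.Perm (Fin 2), (s 0 = 0 ∧ s 1 = 1 ∧ Equiv.Perm.sign s = 1) ∨
      (s 0 = 1 ∧ s 1 = 0 ∧ Equiv.Perm.sign s = -1) := by decide
  rcases h s with ⟨h0, h1, h2⟩ | ⟨h0, h1, h2⟩ <;> simp [pairSign, h0, h1, h2]

/-- The permutation of the index set which permutes the pairs by `τ` and the `k`-th pair by `s k`. -/
def blockPerm {m : ℕ} (x : Equiv.Perm (Fin m) × (Fin m → Equiv.Perm (Fin 2))) :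
    Equiv.Perm (Fin m × Fin 2) :=
  Equiv.prodCongrLeft (fun _ => x.1) * Equiv.prodCongrRight x.2

lemma blockPerm_apply {m : ℕ} (x : Equiv.Perm (Fin m) × (Fin m → Equiv.Perm (Fin 2)))
    (k : Fin m) (a : Fin 2) : blockPerm x (k, a) = (x.1 k, x.2 k a) := rfl

lemma blockPerm_injective {m : ℕ} : Function.Injective (blockPerm (m := m)) := by
  rintro ⟨τ, s⟩ ⟨τ', s'⟩ h
  have h' : ∀ k a, (τ k, s k a) = (τ' k, s' k a) := fun k a => by
    rw [← blockPerm_apply (τ, s), h, blockPerm_apply]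
  simp only [Prod.mk.injEq] at h'
  refine Prod.ext (Equiv.ext fun k => (h' k 0).1) (funext fun k => Equiv.ext fun a => (h' k a).2)

/-- The permutation `τ` of the pairs acts once on each of the two slots, so its sign enters squared.
-/
lemma sign_blockPerm {m : ℕ} (x : Equiv.Perm (Fin m) × (Fin m → Equiv.Perm (Fin 2))) :
    Equiv.Perm.sign (blockPerm x) = ∏ k, Equiv.Perm.sign (x.2 k) := by
  rw [blockPerm, Equiv.Perm.sign_mul, Equiv.Perm.sign_prodCongrLeft, Equiv.Perm.sign_prodCongrRight]
  simp

/-- Each pair fills the whole block it is sent to, so two pairs cannot share a block and the induced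
map on blocks is a permutation. -/
lemma exists_blockPerm_eq {m : ℕ} (σ : Equiv.Perm (Fin m × Fin 2))
    (h : ∀ k, (σ (k, 0)).1 = (σ (k, 1)).1) : ∃ x, blockPerm x = σ := by
  have h1 : ∀ k a, (σ (k, a)).1 = (σ (k, 0)).1 := by
    intro k a
    fin_cases a
    · rfl
    · exact (h k).symm
  have hs : ∀ k, Function.Injective fun a => (σ (k, a)).2 := by
    intro k a b hab
    have := σ.injective (Prod.ext ((h1 k a).trans (h1 k b).symm) hab)
    exact (Prod.mk.inj this).2
  have hs' : ∀ k, Function.Bijective fun a => (σ (k, a)).2 := fun k =>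
    Finite.injective_iff_bijective.mp (hs k)
  have hτ : Function.Injective fun k => (σ (k, 0)).1 := by
    intro k l hkl
    obtain ⟨a, ha⟩ := (hs' k).2 (σ (l, 0)).2
    have := σ.injective (Prod.ext ((h1 k a).trans hkl) ha)
    exact (Prod.mk.inj this).1
  refine ⟨(Equiv.ofBijective _ (Finite.injective_iff_bijective.mp hτ),
    fun k => Equiv.ofBijective _ (hs' k)), ?_⟩
  ext1 ⟨k, a⟩
  rw [blockPerm_apply]
  exact Prod.ext (h1 k a).symm rfl

/-- This evaluates the top power of the standard form on the real frame. Only the `2^m m!`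
permutations that keep pairs together contribute, and each contributes `1` because its sign cancels
the product of the pair signs. -/
lemma sum_sign_mul_prod_pairSign (m : ℕ) :
    ∑ σ : Equiv.Perm (Fin m × Fin 2), ((Equiv.Perm.sign σ : ℤ) : ℝ) *
      ∏ k : Fin m, (if (σ (k, 0)).1 = (σ (k, 1)).1 then
        pairSign (σ (k, 0)).2 (σ (k, 1)).2 else 0) = 2 ^ m * (m.factorial : ℝ) := by
  have key := Finset.sum_of_injOn (s := (Finset.univ : Finset (Equiv.Perm (Fin m) ×
      (Fin m → Equiv.Perm (Fin 2))))) (t := Finset.univ) (f := fun _ => (1 : ℝ))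
    (g := fun σ : Equiv.Perm (Fin m × Fin 2) => ((Equiv.Perm.sign σ : ℤ) : ℝ) *
      ∏ k : Fin m, (if (σ (k, 0)).1 = (σ (k, 1)).1 then
        pairSign (σ (k, 0)).2 (σ (k, 1)).2 else 0)) blockPerm
    (blockPerm_injective.injOn) (fun _ _ => Finset.mem_coe.mpr (Finset.mem_univ _)) ?_ ?_
  · rw [← key]
    simp [Fintype.card_perm, mul_comm]
  · intro σ _ hσ
    by_contra hne
    apply hσ
    have h : ∀ k, (σ (k, 0)).1 = (σ (k, 1)).1 := by
      intro k
      by_contra hk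
      exact hne (mul_eq_zero_of_right _ (Finset.prod_eq_zero (Finset.mem_univ k) (if_neg hk)))
    obtain ⟨x, hx⟩ := exists_blockPerm_eq σ h
    exact ⟨x, Finset.mem_coe.mpr (Finset.mem_univ _), hx⟩
  · intro x _
    simp only [blockPerm_apply, if_true, pairSign_perm, sign_blockPerm]
    push_cast
    rw [← Finset.prod_mul_distrib]
    symm
    apply Finset.prod_eq_one
    intro k _
    rcases Int.units_eq_one_or (Equiv.Perm.sign (x.2 k)) with h | h <;> simp [h]

section Bilinear

variable {V : Type*} [AddCommGroup V] [Module ℝ V] [TopologicalSpace V] (θ : V [⋀^Fin 2]→L[ℝ] ℝ)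

lemma form_add_left (x x' y : V) : θ ![x + x', y] = θ ![x, y] + θ ![x', y] := by
  have e : ∀ x : V, ![x, y] = Function.update ![0, y] 0 x := by
    intro x; ext i; fin_cases i <;> rfl
  rw [e (x + x'), e x, e x', θ.map_update_add]

lemma form_smul_left (c : ℝ) (x y : V) : θ ![c • x, y] = c * θ ![x, y] := by
  have e : ∀ x : V, ![x, y] = Function.update ![0, y] 0 x := by
    intro x; ext i; fin_cases i <;> rfl
  rw [e (c • x), e x, θ.map_update_smul, smul_eq_mul]

lemma form_swap (x y : V) : θ ![x, y] = -θ ![y, x] := by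
  have := θ.toAlternatingMap.map_swap ![y, x] (show (0 : Fin 2) ≠ 1 by decide)
  rw [show (![y, x] ∘ Equiv.swap (0 : Fin 2) 1) = ![x, y] by ext i; fin_cases i <;> simp] at this
  exact this

lemma form_add_right (x y y' : V) : θ ![x, y + y'] = θ ![x, y] + θ ![x, y'] := by
  rw [form_swap, form_add_left, form_swap θ x y, form_swap θ x y']
  ring

lemma form_smul_right (c : ℝ) (x y : V) : θ ![x, c • y] = c * θ ![x, y] := by
  rw [form_swap, form_smul_left, form_swap θ x y]
  ring

lemma form_self (x : V) : θ ![x, x] = 0 := by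
  linarith [form_swap θ x x]

end Bilinear

/-- `v ↦ ∏ₖ θ (v (k,0), v (k,1))` as a multilinear map. -/
def pairProduct {V : Type*} [AddCommGroup V] [Module ℝ V] [TopologicalSpace V] (m : ℕ)
    (θ : V [⋀^Fin 2]→L[ℝ] ℝ) : MultilinearMap ℝ (fun _ : Fin m × Fin 2 => V) ℝ where
  toFun v := ∏ k : Fin m, θ ![v (k, 0), v (k, 1)]
  map_update_add' := by
    intro _ v ⟨k, a⟩ x y
    classical
    -- The slot `(k, a)` occurs only in the `k`-th factor, so linearity reduces to that of `θ` in
    -- one argument.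
    have hne : ∀ z, ∀ l ∈ Finset.univ.erase k,
        θ ![Function.update v (k, a) z (l, 0), Function.update v (k, a) z (l, 1)] =
          θ ![v (l, 0), v (l, 1)] := by
      intro z l hl
      have : l ≠ k := (Finset.mem_erase.mp hl).1
      rw [Function.update_of_ne (by simp [this]), Function.update_of_ne (by simp [this])]
    have inst : ‹DecidableEq (Fin m × Fin 2)› = instDecidableEqProd := Subsingleton.elim _ _
    subst inst
    simp only [← Finset.mul_prod_erase Finset.univ _ (Finset.mem_univ k)]
    rw [Finset.prod_congr rfl (hne (x + y)), Finset.prod_congr rfl (hne x),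
      Finset.prod_congr rfl (hne y), ← add_mul]
    congr 1
    fin_cases a
    · simp [form_add_left]
    · simp [form_add_right]
  map_update_smul' := by
    intro _ v ⟨k, a⟩ c x
    classical
    have hne : ∀ z, ∀ l ∈ Finset.univ.erase k,
        θ ![Function.update v (k, a) z (l, 0), Function.update v (k, a) z (l, 1)] =
          θ ![v (l, 0), v (l, 1)] := by
      intro z l hl
      have : l ≠ k := (Finset.mem_erase.mp hl).1
      rw [Function.update_of_ne (by simp [this]), Function.update_of_ne (by simp [this])]
    have inst : ‹DecidableEq (Fin m × Fin 2)› = instDecidableEqProd := Subsingleton.elim _ _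
    subst inst
    simp only [← Finset.mul_prod_erase Finset.univ _ (Finset.mem_univ k)]
    rw [Finset.prod_congr rfl (hne (c • x)), Finset.prod_congr rfl (hne x), smul_eq_mul,
      ← mul_assoc]
    congr 1
    fin_cases a
    · simp [form_smul_left]
    · simp [form_smul_right]

/-- `topPower` as an alternating map. -/
def topPowerAlt {V : Type*} [AddCommGroup V] [Module ℝ V] [TopologicalSpace V] (m : ℕ)
    (θ : V [⋀^Fin 2]→L[ℝ] ℝ) : V [⋀^Fin m × Fin 2]→ₗ[ℝ] ℝ :=
  (1 / (2 ^ m * (m.factorial : ℝ))) • MultilinearMap.alternatization (pairProduct m θ)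

lemma topPowerAlt_apply {V : Type*} [AddCommGroup V] [Module ℝ V] [TopologicalSpace V] (m : ℕ)
    (θ : V [⋀^Fin 2]→L[ℝ] ℝ) (v : Fin m × Fin 2 → V) : topPowerAlt m θ v = topPower m θ v := by
  simp only [topPowerAlt, AlternatingMap.smul_apply, MultilinearMap.alternatization_apply, topPower,
    smul_eq_mul]
  congr 1
  refine Finset.sum_congr rfl fun σ _ => ?_
  rw [Units.smul_def, zsmul_eq_mul]
  rfl

/-- The real coordinates `x₁, y₁, …` on `ℂ^m`. -/
def realCoords (m : ℕ) : EuclideanSpace ℂ (Fin m) ≃ₗ[ℝ] (Fin m × Fin 2 → ℝ) where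
  toFun z a := if a.2 = 0 then (z a.1).re else (z a.1).im
  invFun c := WithLp.toLp 2 fun k => ⟨c (k, 0), c (k, 1)⟩
  map_add' z w := by ext a; dsimp only [Pi.add_apply]; split_ifs <;> simp
  map_smul' c z := by ext a; dsimp only [Pi.smul_apply, RingHom.id_apply]; split_ifs <;> simp
  left_inv z := by ext k; simp
  right_inv c := by
    ext ⟨k, a⟩
    fin_cases a <;> simp

/-- The basis of `ℂ^m` over `ℝ` dual to the real coordinates. -/
def realBasis (m : ℕ) : Module.Basis (Fin m × Fin 2) ℝ (EuclideanSpace ℂ (Fin m)) :=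
  Module.Basis.ofEquivFun (realCoords m)

lemma realBasis_eq (m : ℕ) : ⇑(realBasis m) = realFrame m := by
  ext ⟨k, a⟩ j
  rw [realBasis, Module.Basis.coe_ofEquivFun]
  have : (realCoords m).symm (Pi.single (k, a) 1) j =
    ⟨(Pi.single (k, a) 1 : Fin m × Fin 2 → ℝ) (j, 0),
      (Pi.single (k, a) 1 : Fin m × Fin 2 → ℝ) (j, 1)⟩ := rfl
  rw [this]
  fin_cases a <;> by_cases h : j = k <;> simp [realFrame, h, Complex.ext_iff]

lemma realBasis_det (m : ℕ) (v : Fin m × Fin 2 → EuclideanSpace ℂ (Fin m)) :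
    (realBasis m).det v = euclideanVolumeForm m v := by
  rw [Module.Basis.det_apply, euclideanVolumeForm, ← Matrix.det_transpose]
  rfl

/-- The coefficient of `θ^{∧m} / m!` with respect to the Euclidean volume form. -/
def density {m : ℕ} (θ : EuclideanSpace ℂ (Fin m) [⋀^Fin 2]→L[ℝ] ℝ) : ℝ :=
  topPower m θ (realFrame m)

/-- Alternating forms of top degree are multiples of the determinant in a basis, with the factor
read off on that basis. -/
lemma topPower_eq {m : ℕ} (θ : EuclideanSpace ℂ (Fin m) [⋀^Fin 2]→L[ℝ] ℝ)
    (v : Fin m × Fin 2 → EuclideanSpace ℂ (Fin m)) :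
    topPower m θ v = density θ * euclideanVolumeForm m v := by
  rw [← topPowerAlt_apply, AlternatingMap.eq_smul_basis_det (realBasis m) (topPowerAlt m θ),
    AlternatingMap.smul_apply, realBasis_det, realBasis_eq, topPowerAlt_apply, density, smul_eq_mul]

/-- The real determinant of a complex-linear map is the norm from `ℂ` to `ℝ` of its complex
determinant. -/
lemma det_restrictScalars_eq {m : ℕ}
    (A : EuclideanSpace ℂ (Fin m) →L[ℂ] EuclideanSpace ℂ (Fin m)) :
    (A.restrictScalars ℝ).det = ‖A.det‖ ^ 2 := by
  simp [ContinuousLinearMap.det, LinearMap.det_restrictScalars,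
      Algebra.norm_complex_eq, Complex.normSq_eq_norm_sq]

lemma euclideanVolumeForm_comp {m : ℕ}
    (A : EuclideanSpace ℂ (Fin m) →L[ℂ] EuclideanSpace ℂ (Fin m))
    (v : Fin m × Fin 2 → EuclideanSpace ℂ (Fin m)) :
    euclideanVolumeForm m (fun a => A (v a)) = ‖A.det‖ ^ 2 * euclideanVolumeForm m v := by
  rw [← realBasis_det, ← realBasis_det, ← det_restrictScalars_eq, ContinuousLinearMap.det,
    ← Module.Basis.det_comp]
  congr 1

lemma euclideanVolumeForm_realFrame (m : ℕ) : euclideanVolumeForm m (realFrame m) = 1 := by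
  rw [← realBasis_det, ← realBasis_eq, Module.Basis.det_self]

lemma topPower_comp {V W : Type*} [AddCommGroup V] [Module ℝ V] [TopologicalSpace V]
    [AddCommGroup W] [Module ℝ W] [TopologicalSpace W] (m : ℕ) (θ : W [⋀^Fin 2]→L[ℝ] ℝ)
    (A : V →L[ℝ] W) (v : Fin m × Fin 2 → V) :
    topPower m (θ.compContinuousLinearMap A) v = topPower m θ (fun a => A (v a)) := by
  simp only [topPower, ContinuousAlternatingMap.compContinuousLinearMap_apply]
  congr! 5 with σ _ k _
  ext i
  fin_cases i <;> rfl

/-- This transformation law serves twice: it makes the chart measures agree on overlaps, and it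
splits off the term `2 log |det|` in the harmonicity argument. -/
lemma density_comp {m : ℕ} (θ : EuclideanSpace ℂ (Fin m) [⋀^Fin 2]→L[ℝ] ℝ)
    (A : EuclideanSpace ℂ (Fin m) →L[ℂ] EuclideanSpace ℂ (Fin m)) :
    density (θ.compContinuousLinearMap (A.restrictScalars ℝ)) = ‖A.det‖ ^ 2 * density θ := by
  rw [density, topPower_comp, topPower_eq]
  simp only [ContinuousLinearMap.coe_restrictScalars']
  rw [euclideanVolumeForm_comp, euclideanVolumeForm_realFrame]
  ring

lemma single_I {m : ℕ} (j : Fin m) : (EuclideanSpace.single j Complex.I : EuclideanSpace ℂ (Fin m)) =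
    Complex.I • EuclideanSpace.single j 1 := by
  ext k
  by_cases h : k = j <;> simp [h]

lemma compContinuousLinearMap_pair {m : ℕ} (θ : EuclideanSpace ℂ (Fin m) [⋀^Fin 2]→L[ℝ] ℝ)
    (A : EuclideanSpace ℂ (Fin m) →L[ℂ] EuclideanSpace ℂ (Fin m)) (v w : EuclideanSpace ℂ (Fin m)) :
    θ.compContinuousLinearMap (A.restrictScalars ℝ) ![v, w] = θ ![A v, A w] := by
  rw [ContinuousAlternatingMap.compContinuousLinearMap_apply]
  congr 1
  ext i
  fin_cases i <;> rfl

/-! ### Positive `(1,1)`-forms, their Hermitian matrices and their top powers. -/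

/-- A real 2-form on `ℂ^m` which is the imaginary part of a Hermitian metric. -/
structure IsPositive {m : ℕ} (θ : EuclideanSpace ℂ (Fin m) [⋀^Fin 2]→L[ℝ] ℝ) : Prop where
  invariant : ∀ v w, θ ![Complex.I • v, Complex.I • w] = θ ![v, w]
  pos : ∀ v, v ≠ 0 → 0 < θ ![v, Complex.I • v]

namespace IsPositive

variable {m : ℕ} {θ : EuclideanSpace ℂ (Fin m) [⋀^Fin 2]→L[ℝ] ℝ}

lemma I_right (h : IsPositive θ) (v w : EuclideanSpace ℂ (Fin m)) :
    θ ![v, Complex.I • w] = -θ ![Complex.I • v, w] := by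
  have h1 := h.invariant v (Complex.I • w)
  rw [smul_smul, Complex.I_mul_I, show (-1 : ℂ) • w = (-1 : ℝ) • w by simp,
    form_smul_right] at h1
  linarith

lemma comp (h : IsPositive θ) (A : EuclideanSpace ℂ (Fin m) →L[ℂ] EuclideanSpace ℂ (Fin m))
    (hA : Function.Injective A) : IsPositive (θ.compContinuousLinearMap (A.restrictScalars ℝ)) := by
  refine ⟨fun v w => ?_, fun v hv => ?_⟩
  · rw [compContinuousLinearMap_pair, compContinuousLinearMap_pair, map_smul, map_smul, h.invariant]
  · rw [compContinuousLinearMap_pair, map_smul]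
    exact h.pos _ fun h0 => hv (hA (h0.trans (map_zero A).symm))

/-- The Hermitian metric `(v, w) ↦ θ(v, i w) - i θ(v, w)`, linear in `v`. -/
def metric (h : IsPositive θ) :
    EuclideanSpace ℂ (Fin m) →ₗ[ℂ] EuclideanSpace ℂ (Fin m) →ₛₗ[starRingEnd ℂ] ℂ :=
  LinearMap.mk₂'ₛₗ (RingHom.id ℂ) (starRingEnd ℂ)
    (fun v w => (θ ![v, Complex.I • w] : ℂ) - Complex.I * (θ ![v, w] : ℂ))
    (fun v v' w => by simp only [form_add_left, Complex.ofReal_add]; ring)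
    (fun c v w => by
      have hc : c • v = c.re • v + c.im • (Complex.I • v) := by
        conv_lhs => rw [← Complex.re_add_im c, add_smul, mul_smul]
        rfl
      have hI := h.I_right v w
      simp only [hc, form_add_left, form_smul_left, h.invariant, RingHom.id_apply, smul_eq_mul]
      rw [hI]
      apply Complex.ext <;> simp <;> ring)
    (fun v w w' => by simp only [smul_add, form_add_right, Complex.ofReal_add]; ring)
    (fun c v w => by
      have hc : c • w = c.re • w + c.im • (Complex.I • w) := by
        conv_lhs => rw [← Complex.re_add_im c, add_smul, mul_smul]
        rfl
      have hc' : Complex.I • c • w = c.re • (Complex.I • w) + (-c.im) • w := by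
        rw [hc, smul_add, smul_comm Complex.I c.re, smul_comm Complex.I c.im, smul_smul Complex.I,
          Complex.I_mul_I]
        simp
      simp only [hc', form_add_right, form_smul_right]
      rw [hc]
      simp only [form_add_right, form_smul_right, smul_eq_mul]
      apply Complex.ext <;> (simp; ring))

lemma metric_apply (h : IsPositive θ) (v w : EuclideanSpace ℂ (Fin m)) :
    h.metric v w = (θ ![v, Complex.I • w] : ℂ) - Complex.I * (θ ![v, w] : ℂ) := rfl

lemma metric_conj (h : IsPositive θ) (v w : EuclideanSpace ℂ (Fin m)) :
    starRingEnd ℂ (h.metric v w) = h.metric w v := by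
  have h1 : θ ![v, Complex.I • w] = θ ![w, Complex.I • v] := by
    rw [h.I_right, form_swap, neg_neg]
  have h2 := form_swap θ v w
  rw [metric_apply, metric_apply]
  apply Complex.ext <;> simp [h1, h2]

lemma metric_sum_sum (h : IsPositive θ) (a b : Fin m → ℂ) :
    h.metric (∑ i, a i • EuclideanSpace.single i 1) (∑ j, b j • EuclideanSpace.single j 1) =
      ∑ i, ∑ j, a i * starRingEnd ℂ (b j) *
        h.metric (EuclideanSpace.single i 1) (EuclideanSpace.single j 1) := by
  rw [map_sum h.metric, LinearMap.sum_apply]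
  refine Finset.sum_congr rfl fun i _ => ?_
  rw [map_smul, LinearMap.smul_apply, map_sum, smul_eq_mul, Finset.mul_sum]
  refine Finset.sum_congr rfl fun j _ => ?_
  rw [LinearMap.map_smulₛₗ, smul_eq_mul, mul_assoc]

lemma hermitianMatrix_apply (h : IsPositive θ) (i j : Fin m) :
    hermitianMatrix θ i j =
      (1 / 2 : ℂ) * h.metric (EuclideanSpace.single i 1) (EuclideanSpace.single j 1) := by
  rw [hermitianMatrix, metric_apply, ← single_I]
  rfl

open scoped ComplexOrder in
lemma posDef (h : IsPositive θ) : (hermitianMatrix θ).PosDef := by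
  refine Matrix.PosDef.of_dotProduct_mulVec_pos ?_ ?_
  · ext i j
    rw [Matrix.conjTranspose_apply, h.hermitianMatrix_apply, h.hermitianMatrix_apply]
    simp [h.metric_conj]
  · intro x hx
    -- The coordinates are conjugated because `metric` is linear in its first argument, whereas
    -- `star x ⬝ᵥ H x` conjugates the first factor.
    set v : EuclideanSpace ℂ (Fin m) := ∑ i, star (x i) • EuclideanSpace.single i (1 : ℂ) with hv
    have hvi : ∀ i, v i = star (x i) := by
      intro i
      simp [hv, Finset.sum_apply, Pi.single_apply]
    have hv0 : v ≠ 0 := by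
      intro h0
      apply hx
      ext i
      have := hvi i
      rw [h0] at this
      simpa using this.symm
    have key : star x ⬝ᵥ (hermitianMatrix θ).mulVec x = (1 / 2 : ℂ) * h.metric v v := by
      rw [hv, h.metric_sum_sum]
      simp only [dotProduct, Matrix.mulVec, Finset.mul_sum, h.hermitianMatrix_apply]
      refine Finset.sum_congr rfl fun i _ => Finset.sum_congr rfl fun j _ => ?_
      simp
      ring
    have hp := h.pos v hv0
    rw [key, metric_apply, form_self]
    rw [Complex.lt_def]
    constructor
    · simpa using hp
    · simp

lemma hermitianMatrix_comp (h : IsPositive θ)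
    (A : EuclideanSpace ℂ (Fin m) →L[ℂ] EuclideanSpace ℂ (Fin m)) (M : Matrix (Fin m) (Fin m) ℂ)
    (hM : ∀ i, A (EuclideanSpace.single i 1) = ∑ k, M k i • EuclideanSpace.single k (1 : ℂ)) :
    hermitianMatrix (θ.compContinuousLinearMap (A.restrictScalars ℝ)) =
      M.transpose * hermitianMatrix θ * M.map (starRingEnd ℂ) := by
  ext i j
  have h1 : hermitianMatrix (θ.compContinuousLinearMap (A.restrictScalars ℝ)) i j =
      (1 / 2 : ℂ) * h.metric (A (EuclideanSpace.single i 1)) (A (EuclideanSpace.single j 1)) := by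
    rw [hermitianMatrix, metric_apply]
    simp only [Matrix.of_apply, compContinuousLinearMap_pair, single_I, map_smul]
  rw [h1, hM, hM, h.metric_sum_sum]
  simp only [Matrix.mul_apply, Finset.mul_sum, Finset.sum_mul, h.hermitianMatrix_apply,
    Matrix.transpose_apply, Matrix.map_apply]
  rw [Finset.sum_comm]
  refine Finset.sum_congr rfl fun k _ => Finset.sum_congr rfl fun l _ => ?_
  ring

/-- The matrix `δ_{ij} / 2` forces `θ = ∑ dxₖ ∧ dyₖ`, for which the top power is the sum over block
permutations computed above. -/
lemma density_of_hermitianMatrix_eq (h : IsPositive θ)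
    (h1 : hermitianMatrix θ = (1 / 2 : ℂ) • (1 : Matrix (Fin m) (Fin m) ℂ)) : density θ = 1 := by
  have hij : ∀ i j : Fin m,
      θ ![EuclideanSpace.single i 1, EuclideanSpace.single j Complex.I] = (if i = j then 1 else 0) ∧
      θ ![EuclideanSpace.single i 1, EuclideanSpace.single j 1] = 0 := by
    intro i j
    have := congrFun (congrFun h1 i) j
    rw [hermitianMatrix, Matrix.of_apply, Matrix.smul_apply, smul_eq_mul,
      mul_right_inj' (by norm_num), Matrix.one_apply] at this
    constructor
    · have := congrArg Complex.re this
      split_ifs at this ⊢ <;> simpa using this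
    · have := congrArg Complex.im this
      split_ifs at this <;> simpa using this
  have hf : ∀ p q : Fin m × Fin 2, θ ![realFrame m p, realFrame m q] =
      if p.1 = q.1 then pairSign p.2 q.2 else 0 := by
    rintro ⟨i, a⟩ ⟨j, b⟩
    fin_cases a <;> fin_cases b <;> simp only [realFrame, Fin.zero_eta, Fin.mk_one, if_true,
      one_ne_zero, if_false, Fin.isValue]
    · simp [(hij i j).2, pairSign]
    · simp [(hij i j).1, pairSign]
    · rw [form_swap, (hij j i).1]
      by_cases hh : i = j <;> simp [pairSign, hh, eq_comm]
    · rw [single_I, single_I, h.invariant, (hij i j).2]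
      simp [pairSign]
  rw [density, topPower]
  simp only [hf]
  rw [sum_sign_mul_prod_pairSign, one_div, inv_mul_cancel₀]
  positivity

open scoped MatrixOrder ComplexOrder in
-- Write the positive definite matrix as `C^* C` with `C` invertible. Then `M` is `√(1/2)` times the
-- entrywise conjugate of `C⁻¹`.
lemma exists_conj_eq (h : IsPositive θ) : ∃ M : Matrix (Fin m) (Fin m) ℂ,
    M.transpose * hermitianMatrix θ * M.map (starRingEnd ℂ) =
      (1 / 2 : ℂ) • (1 : Matrix (Fin m) (Fin m) ℂ) := by
  obtain ⟨C, hC, hCe⟩ := CStarAlgebra.isStrictlyPositive_iff_eq_star_mul_self.mp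
    h.posDef.isStrictlyPositive
  obtain ⟨c, hc⟩ : ∃ c : ℝ, (c : ℂ) * c = 1 / 2 := by
    refine ⟨Real.sqrt (1 / 2), ?_⟩
    rw [← Complex.ofReal_mul, Real.mul_self_sqrt (by norm_num)]
    simp
  lift C to (Matrix (Fin m) (Fin m) ℂ)ˣ using hC
  refine ⟨(c : ℂ) • (C⁻¹ : (Matrix (Fin m) (Fin m) ℂ)ˣ).1.map (starRingEnd ℂ), ?_⟩
  have e1 : ((c : ℂ) • (C⁻¹ : (Matrix (Fin m) (Fin m) ℂ)ˣ).1.map (starRingEnd ℂ)).transpose =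
      (c : ℂ) • star (C⁻¹ : (Matrix (Fin m) (Fin m) ℂ)ˣ).1 := by
    ext i j; simp
  have e2 : ((c : ℂ) • (C⁻¹ : (Matrix (Fin m) (Fin m) ℂ)ˣ).1.map (starRingEnd ℂ)).map
      (starRingEnd ℂ) = (c : ℂ) • (C⁻¹ : (Matrix (Fin m) (Fin m) ℂ)ˣ).1 := by
    ext i j; simp
  rw [e1, e2, hCe, Matrix.smul_mul, Matrix.smul_mul, Matrix.mul_smul, smul_smul, hc]
  congr 1
  rw [← mul_assoc, ← star_mul, Units.mul_inv, star_one, one_mul, Units.mul_inv]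

open scoped ComplexOrder in
lemma det_pos (h : IsPositive θ) : 0 < (hermitianMatrix θ).det.re := by
  have := h.posDef.det_pos
  rw [Complex.lt_def] at this
  simpa using this.1

open scoped ComplexOrder in
lemma det_eq_re (h : IsPositive θ) : (hermitianMatrix θ).det = ((hermitianMatrix θ).det.re : ℂ) := by
  have := h.posDef.det_pos
  rw [Complex.lt_def] at this
  exact Complex.ext (by simp) (by simpa using this.2.symm)

/-- Under pull-back by an invertible complex-linear map both sides are multiplied by the squared
modulus of its determinant. So it suffices to compare them where the matrix is half the identity,
and there both are `1`. -/
lemma density_eq (h : IsPositive θ) : density θ = 2 ^ m * (hermitianMatrix θ).det.re := by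
  obtain ⟨M, hM⟩ := h.exists_conj_eq
  let A : EuclideanSpace ℂ (Fin m) →L[ℂ] EuclideanSpace ℂ (Fin m) :=
    LinearMap.toContinuousLinearMap (Matrix.toLin (PiLp.basisFun 2 ℂ (Fin m))
      (PiLp.basisFun 2 ℂ (Fin m)) M)
  have hA : ∀ i, A (EuclideanSpace.single i 1) =
      ∑ k, M k i • EuclideanSpace.single k (1 : ℂ) := by
    intro i
    have := Matrix.toLin_self (PiLp.basisFun 2 ℂ (Fin m)) (PiLp.basisFun 2 ℂ (Fin m)) M i
    simp only [PiLp.basisFun_apply] at this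
    exact this
  have hdet : A.det = M.det := by
    rw [ContinuousLinearMap.det]
    exact LinearMap.det_toLin _ _
  have hd := congrArg Matrix.det hM
  rw [Matrix.det_mul, Matrix.det_mul, Matrix.det_transpose, Matrix.det_smul, Matrix.det_one,
    Fintype.card_fin, mul_one] at hd
  have hmap : (M.map (starRingEnd ℂ)).det = starRingEnd ℂ M.det :=
    (RingHom.map_det (starRingEnd ℂ) M).symm
  rw [hmap, mul_right_comm, Complex.mul_conj, h.det_eq_re, ← Complex.ofReal_mul,
    show (1 / 2 : ℂ) ^ m = (((1 / 2 : ℝ) ^ m : ℝ) : ℂ) by push_cast; rfl, Complex.ofReal_inj,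
    Complex.normSq_eq_norm_sq] at hd
  have hM0 : M.det ≠ 0 := by
    intro h0
    rw [h0, norm_zero, zero_pow two_ne_zero, zero_mul] at hd
    exact absurd hd.symm (by positivity)
  have hinj : Function.Injective A := by
    have hu : IsUnit (LinearMap.det (A : EuclideanSpace ℂ (Fin m) →ₗ[ℂ] EuclideanSpace ℂ (Fin m))) := by
      change IsUnit A.det
      rw [hdet]; exact hM0.isUnit
    exact ((LinearMap.isUnit_iff_isUnit_det _).mpr hu |> (Module.End.isUnit_iff _).mp).1
  have h2 := (h.comp A hinj).density_of_hermitianMatrix_eq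
    (by rw [h.hermitianMatrix_comp A M hA, hM])
  rw [density_comp, hdet] at h2
  have h3 : ‖M.det‖ ^ 2 ≠ 0 := by positivity
  apply mul_left_cancel₀ h3
  rw [h2, mul_left_comm, hd, ← mul_pow]
  norm_num

end IsPositive

/-! ### Holomorphic functions of several variables -/

section Holomorphic

open Metric Set Filter

/-- A first-order Taylor estimate whose constant depends only on the bound `M` and the radius. This
makes difference quotients converge uniformly in a parameter. -/
lemma norm_sub_sub_smul_deriv_le {F : Type*} [NormedAddCommGroup F] [NormedSpace ℂ F]
    [CompleteSpace F] {f : ℂ → F} {r M : ℝ} (hr : 0 < r) (hf : DifferentiableOn ℂ f (ball 0 (4 * r)))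
    (hM : ∀ t ∈ ball (0 : ℂ) (4 * r), ‖f t‖ ≤ M) {t : ℂ} (ht : ‖t‖ < r) :
    ‖f t - f 0 - t • deriv f 0‖ ≤ M / r / r * ‖t‖ * ‖t‖ := by
  have hf' : DifferentiableOn ℂ (deriv f) (ball 0 (4 * r)) := hf.deriv isOpen_ball
  have cauchy : ∀ {g : ℂ → F} {R C : ℝ}, 0 < R → DifferentiableOn ℂ g (ball 0 (4 * r)) →
      (∀ s ∈ ball (0 : ℂ) (R + r), ‖g s‖ ≤ C) → R + r ≤ 4 * r → ∀ s ∈ ball (0 : ℂ) R,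
      ‖deriv g s‖ ≤ C / r := by
    intro g R C hR hg hC hR4 s hs
    have hsub : closedBall s r ⊆ ball 0 (R + r) := by
      intro x hx
      rw [mem_ball, dist_zero_right] at hs ⊢
      rw [mem_closedBall, dist_eq_norm] at hx
      calc ‖x‖ = ‖(x - s) + s‖ := by rw [sub_add_cancel]
        _ ≤ ‖x - s‖ + ‖s‖ := norm_add_le _ _
        _ < R + r := by linarith
    refine Complex.norm_deriv_le_of_forall_mem_sphere_norm_le hr ?_ fun z hz => hC z (hsub
      (sphere_subset_closedBall hz))
    refine (hg.mono ?_).diffContOnCl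
    rw [closure_ball s hr.ne']
    exact hsub.trans (ball_subset_ball hR4)
  -- Each Cauchy estimate gives up `r` of the radius: from `3r` to `2r` for the first derivative,
  -- then from `2r` to `r` for the second.
  have h1 : ∀ s ∈ ball (0 : ℂ) (2 * r), ‖deriv f s‖ ≤ M / r :=
    cauchy (by positivity) hf (fun s hs => hM s (ball_subset_ball (by linarith) hs)) (by linarith)
  have h2 : ∀ s ∈ ball (0 : ℂ) r, ‖deriv (deriv f) s‖ ≤ M / r / r :=
    cauchy hr hf' (fun s hs => h1 s (ball_subset_ball (by linarith) hs)) (by linarith)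
  have hr4 : ball (0 : ℂ) r ⊆ ball 0 (4 * r) := ball_subset_ball (by linarith)
  have h3 : ∀ s ∈ ball (0 : ℂ) r, ‖deriv f s - deriv f 0‖ ≤ M / r / r * ‖s‖ := by
    intro s hs
    have := (convex_ball (0 : ℂ) r).norm_image_sub_le_of_norm_deriv_le
      (fun x hx => hf'.differentiableAt (isOpen_ball.mem_nhds (hr4 hx))) h2
      (mem_ball_self hr) hs
    simpa using this
  have hd : ∀ s ∈ ball (0 : ℂ) (4 * r),
      HasDerivAt (fun s => f s - s • deriv f 0) (deriv f s - deriv f 0) s := by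
    intro s hs
    have := (hf.differentiableAt (isOpen_ball.mem_nhds hs)).hasDerivAt.sub
      ((hasDerivAt_id' s).smul_const (deriv f 0))
    rw [one_smul] at this
    exact this
  have htr : closedBall (0 : ℂ) ‖t‖ ⊆ ball 0 r := closedBall_subset_ball ht
  -- On the disc of radius `‖t‖` the derivative of `f s - s • f'(0)` is at most `(M / r²) ‖t‖`, and
  -- the mean value inequality supplies the second factor `‖t‖`.
  have h4 := (convex_closedBall (0 : ℂ) ‖t‖).norm_image_sub_le_of_norm_hasDerivWithin_le
    (C := M / r / r * ‖t‖) (fun x hx => (hd x (hr4 (htr hx))).hasDerivWithinAt)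
    (fun x hx => (h3 x (htr hx)).trans (mul_le_mul_of_nonneg_left (by simpa using hx)
      ((norm_nonneg _).trans (h2 0 (mem_ball_self hr)))))
    (mem_closedBall_self (norm_nonneg t)) (show t ∈ closedBall (0 : ℂ) ‖t‖ by simp)
  have e : f t - t • deriv f 0 - (f 0 - (0 : ℂ) • deriv f 0) = f t - f 0 - t • deriv f 0 := by
    rw [zero_smul]; abel
  rw [e, sub_zero] at h4
  exact h4

/-- The directional derivatives of a holomorphic map of several variables are holomorphic along
complex lines. -/
lemma differentiableOn_fderiv_line {E F : Type*} [NormedAddCommGroup E] [NormedSpace ℂ E]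
    [NormedAddCommGroup F] [NormedSpace ℂ F] [CompleteSpace F] {U : Set E} (hU : IsOpen U)
    {g : E → F} (hg : DifferentiableOn ℂ g U) (z w v : E) :
    DifferentiableOn ℂ (fun ζ : ℂ => fderiv ℂ g (z + ζ • w) v) {ζ | z + ζ • w ∈ U} := by
  intro ζ₀ hζ₀
  apply DifferentiableAt.differentiableWithinAt
  obtain ⟨M, hM⟩ : ∃ M, ∀ᶠ x in 𝓝 (z + ζ₀ • w), ‖g x‖ ≤ M :=
    ⟨‖g (z + ζ₀ • w)‖ + 1, ((hg.continuousOn.continuousAt (hU.mem_nhds hζ₀)).norm.eventually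
      (ge_mem_nhds (lt_add_one _)))⟩
  have hev : ∀ᶠ x in 𝓝 (z + ζ₀ • w), x ∈ U ∧ ‖g x‖ ≤ M := (hU.eventually_mem hζ₀).and hM
  have hc : Tendsto (fun p : ℂ × ℂ => z + p.1 • w + p.2 • v) (𝓝 (ζ₀, 0)) (𝓝 (z + ζ₀ • w)) := by
    have : Continuous fun p : ℂ × ℂ => z + p.1 • w + p.2 • v := by fun_prop
    simpa using this.tendsto (ζ₀, 0)
  obtain ⟨ε, hε, hball⟩ := Metric.eventually_nhds_iff_ball.mp (hc.eventually hev)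
  -- With this radius, `ζ` within `r` of `ζ₀` and `t` of modulus below `4r = ε` stay in the
  -- neighbourhood where `g` is bounded by `M`.
  set r := ε / 4 with hr
  have hr0 : 0 < r := by positivity
  have hin : ∀ ζ ∈ ball ζ₀ r, ∀ t ∈ ball (0 : ℂ) (4 * r),
      z + ζ • w + t • v ∈ U ∧ ‖g (z + ζ • w + t • v)‖ ≤ M := by
    intro ζ hζ t ht
    refine hball (ζ, t) ?_
    rw [mem_ball, Prod.dist_eq, max_lt_iff]
    rw [mem_ball] at hζ ht
    exact ⟨by dsimp only; linarith, by dsimp only; linarith⟩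
  have hder : ∀ ζ ∈ ball ζ₀ r, ∀ t ∈ ball (0 : ℂ) (4 * r),
      HasDerivAt (fun t : ℂ => g (z + ζ • w + t • v)) (fderiv ℂ g (z + ζ • w + t • v) v) t := by
    intro ζ hζ t ht
    have h1 : HasDerivAt (fun t : ℂ => z + ζ • w + t • v) v t := by
      simpa using ((hasDerivAt_id t).smul_const v).const_add (z + ζ • w)
    exact (hg.differentiableAt (hU.mem_nhds (hin ζ hζ t ht).1)).hasFDerivAt.comp_hasDerivAt t h1
  have hM0 : 0 ≤ M := (norm_nonneg _).trans
    (hin ζ₀ (mem_ball_self hr0) 0 (mem_ball_self (by positivity))).2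
  -- The directional derivative is the limit of difference quotients holomorphic in `ζ`, uniformly
  -- near `ζ₀` with error `(M / r²) ‖t‖`. Weierstrass's theorem then makes the limit holomorphic.
  have hlim : TendstoUniformlyOn
      (fun (t ζ : ℂ) => t⁻¹ • (g (z + ζ • w + t • v) - g (z + ζ • w)))
      (fun ζ => fderiv ℂ g (z + ζ • w) v) (𝓝[≠] (0 : ℂ)) (ball ζ₀ r) := by
    rw [Metric.tendstoUniformlyOn_iff]
    intro δ hδ
    have h1 : Tendsto (fun t : ℂ => M / r / r * ‖t‖) (𝓝[≠] 0) (𝓝 0) := by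
      have : Continuous fun t : ℂ => M / r / r * ‖t‖ := by fun_prop
      simpa using (this.tendsto 0).mono_left nhdsWithin_le_nhds
    have h2 : ∀ᶠ t : ℂ in 𝓝[≠] 0, t ∈ ball (0 : ℂ) r :=
      nhdsWithin_le_nhds (ball_mem_nhds 0 hr0)
    filter_upwards [h1.eventually (gt_mem_nhds hδ), h2, self_mem_nhdsWithin] with t ht htr ht0 ζ hζ
    have ht0' : t ≠ 0 := ht0
    have hd0 := (hder ζ hζ 0 (mem_ball_self (by positivity))).deriv
    have := norm_sub_sub_smul_deriv_le hr0
      (fun t ht => (hder ζ hζ t ht).differentiableAt.differentiableWithinAt)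
      (fun t ht => (hin ζ hζ t ht).2) (by simpa using htr)
    rw [hd0] at this
    simp only [zero_smul, add_zero] at this
    rw [dist_eq_norm, norm_sub_rev]
    refine lt_of_le_of_lt ?_ ht
    have e : t⁻¹ • (g (z + ζ • w + t • v) - g (z + ζ • w)) - fderiv ℂ g (z + ζ • w) v =
        t⁻¹ • (g (z + ζ • w + t • v) - g (z + ζ • w) - t • fderiv ℂ g (z + ζ • w) v) := by
      rw [smul_sub t⁻¹ _ (t • _), inv_smul_smul₀ ht0']
    rw [e, norm_smul, norm_inv, inv_mul_le_iff₀ (norm_pos_iff.mpr ht0')]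
    linarith
  have hdiff : ∀ᶠ t : ℂ in 𝓝[≠] 0, DifferentiableOn ℂ
      (fun ζ : ℂ => t⁻¹ • (g (z + ζ • w + t • v) - g (z + ζ • w))) (ball ζ₀ r) := by
    have h2 : ∀ᶠ t : ℂ in 𝓝[≠] 0, t ∈ ball (0 : ℂ) r :=
      nhdsWithin_le_nhds (ball_mem_nhds 0 hr0)
    filter_upwards [h2] with t ht
    have h3 : ∀ t ∈ ball (0 : ℂ) (4 * r),
        DifferentiableOn ℂ (fun ζ : ℂ => g (z + ζ • w + t • v)) (ball ζ₀ r) := by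
      intro t ht ζ hζ
      have h4 : DifferentiableAt ℂ (fun ζ : ℂ => z + ζ • w + t • v) ζ := by fun_prop
      exact ((hg.differentiableAt (hU.mem_nhds (hin ζ hζ t ht).1)).comp ζ h4).differentiableWithinAt
    have h5 := h3 0 (mem_ball_self (by positivity))
    simp only [zero_smul, add_zero] at h5
    exact ((h3 t (ball_subset_ball (by linarith) ht)).sub h5).const_smul _
  exact (hlim.tendstoLocallyUniformlyOn.differentiableOn hdiff isOpen_ball).differentiableAt
    (ball_mem_nhds ζ₀ hr0)

/-- The zero set of a holomorphic function on a ball is a null set unless the function vanishes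
identically. -/
lemma measure_zeros_ball_eq_zero {E : Type*} [NormedAddCommGroup E] [NormedSpace ℂ E]
    [NormedSpace ℝ E] [IsScalarTower ℝ ℂ E] [FiniteDimensional ℝ E] [MeasurableSpace E] [BorelSpace E]
    (μ : Measure E) [μ.IsAddHaarMeasure] {f : E → ℂ} {c : E} {r : ℝ}
    (hf : DifferentiableOn ℂ f (ball c r)) {y₀ : E} (hy₀ : y₀ ∈ ball c r) (hfy : f y₀ ≠ 0) :
    μ (ball c r ∩ f ⁻¹' {0}) = 0 := by
  have hmeas : MeasurableSet (ball c r ∩ f ⁻¹' {0}) := by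
    have h1 := hf.continuousOn.isOpen_inter_preimage isOpen_ball
      (isOpen_compl_singleton (x := (0 : ℂ)))
    have : ball c r ∩ f ⁻¹' {0} = ball c r \ (ball c r ∩ f ⁻¹' {0}ᶜ) := by
      ext x; simp
    rw [this]
    exact measurableSet_ball.diff h1.measurableSet
  -- Polar coordinates are centred at the point `y₀` where `f` does not vanish. Thus `S` avoids the
  -- origin and every ray leaves from a point off the zero set.
  set S : Set E := (fun x => y₀ + x) ⁻¹' (ball c r ∩ f ⁻¹' {0}) with hS
  have hSm : MeasurableSet S := measurable_const_add y₀ hmeas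
  have hSμ : μ S = μ (ball c r ∩ f ⁻¹' {0}) := measure_preimage_add μ y₀ _
  rw [← hSμ]
  have hS0 : S ⊆ {0}ᶜ := by
    intro x hx h0
    rw [mem_singleton_iff] at h0
    subst h0
    have := hx.2
    simp only [add_zero, mem_preimage, mem_singleton_iff] at this
    exact hfy this
  -- A real line through `y₀` lies in a complex line, on which `f` restricts to a holomorphic
  -- function on a convex set, nonzero at `0`. Its zeros are isolated, hence null in the real line.
  have hline : ∀ u : E, volume {t : ℝ | t • u ∈ S} = 0 := by
    intro u
    let h : ℂ → ℂ := fun ζ => f (y₀ + ζ • u)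
    let V : Set ℂ := {ζ | y₀ + ζ • u ∈ ball c r}
    have hVo : IsOpen V := isOpen_ball.preimage (by fun_prop)
    have hVc : Convex ℝ V :=
      ((convex_ball c r).translate_preimage_right y₀).linear_preimage
        ((LinearMap.toSpanSingleton ℂ E u).restrictScalars ℝ)
    have hcoe : ∀ t : ℝ, (t : ℂ) • u = t • u := fun t => algebraMap_smul ℂ t u
    have hh : AnalyticOnNhd ℂ h V := by
      refine DifferentiableOn.analyticOnNhd (fun ζ hζ => ?_) hVo
      have h4 : DifferentiableAt ℂ (fun ζ : ℂ => y₀ + ζ • u) ζ := by fun_prop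
      exact ((hf.differentiableAt (isOpen_ball.mem_nhds hζ)).comp ζ h4).differentiableWithinAt
    have h0V : (0 : ℂ) ∈ V := by simpa [V] using hy₀
    have h00 : h 0 ≠ 0 := by simpa [h] using hfy
    refine measure_null_of_locally_null _ fun t ht => ?_
    have htV : (t : ℂ) ∈ V ∧ h t = 0 := by
      have := ht
      simp only [mem_ofPred_eq, hS, mem_preimage, mem_inter_iff] at this
      simpa [V, h, hcoe] using this
    have hne : ∀ᶠ ζ in 𝓝[≠] (t : ℂ), h ζ ≠ 0 := by
      rcases (hh t htV.1).eventually_eq_zero_or_eventually_ne_zero with he | he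
      · exact absurd (hh.eqOn_zero_of_preconnected_of_eventuallyEq_zero hVc.isPreconnected htV.1 he
          h0V) h00
      · exact he
    have hne' : ∀ᶠ s : ℝ in 𝓝[≠] t, h (s : ℂ) ≠ 0 := by
      have : Tendsto (fun s : ℝ => (s : ℂ)) (𝓝[≠] t) (𝓝[≠] (t : ℂ)) :=
        (Complex.continuous_ofReal.tendsto t).inf
          (tendsto_principal_principal.mpr fun s hs => by simpa using hs)
      exact this.eventually hne
    refine ⟨{t : ℝ | t • u ∈ S} ∩ ({t} ∪ {s : ℝ | h (s : ℂ) ≠ 0}), ?_, ?_⟩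
    · refine inter_mem self_mem_nhdsWithin (nhdsWithin_le_nhds ?_)
      rw [← nhdsNE_sup_pure, mem_sup]
      exact ⟨Filter.mem_of_superset hne' subset_union_right, by simp⟩
    · refine measure_mono_null (t := {t}) ?_ (measure_singleton t)
      rintro s ⟨hs, hs' | hs'⟩
      · exact hs'
      · exfalso
        apply hs'
        have := hs.2
        simpa [h, hcoe] using this
  have hmp := μ.measurePreserving_homeomorphUnitSphereProd
  let T : Set (sphere (0 : E) 1 × Ioi (0 : ℝ)) := {p | p.2.1 • p.1.1 ∈ S}
  have hTm : MeasurableSet T := by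
    have : Continuous fun p : sphere (0 : E) 1 × Ioi (0 : ℝ) => p.2.1 • p.1.1 := by fun_prop
    exact this.measurable hSm
  -- Fubini in polar coordinates: every radial slice of the set is null.
  have hT0 : (μ.toSphere.prod (Measure.volumeIoiPow (Module.finrank ℝ E - 1))) T = 0 := by
    rw [Measure.measure_prod_null hTm]
    refine Filter.Eventually.of_forall fun u => ?_
    refine withDensity_absolutelyContinuous _ _ ?_
    rw [comap_subtype_coe_apply measurableSet_Ioi]
    refine measure_mono_null ?_ (hline u.1)
    rintro _ ⟨t, ht, rfl⟩
    exact ht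
  rw [← hmp.measure_preimage hTm.nullMeasurableSet,
    comap_subtype_coe_apply (measurableSet_singleton _).compl] at hT0
  refine measure_mono_null ?_ hT0
  intro x hx
  refine ⟨⟨x, hS0 hx⟩, ?_, rfl⟩
  have hx0 : ‖x‖ ≠ 0 := norm_ne_zero_iff.mpr (hS0 hx)
  simp only [T, mem_preimage, mem_ofPred_eq, homeomorphUnitSphereProd_apply_snd_coe,
    homeomorphUnitSphereProd_apply_fst_coe]
  rw [smul_inv_smul₀ hx0]
  exact hx

end Holomorphic

/-! ### Pluriharmonic functions -/

section Pluriharmonic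

open Set Filter InnerProductSpace

/-- The real and imaginary parts of `ddbar u` are the values on the real frame of the bilinear form
`D²u(a, b) + D²u(i a, i b)`, up to sign and a factor `1/4`. So this form vanishes identically. -/
lemma fderiv_fderiv_add_eq_zero {m : ℕ} {u : EuclideanSpace ℂ (Fin m) → ℝ}
    {y : EuclideanSpace ℂ (Fin m)} (h : ∀ i j, ddbar u y i j = 0) (a : EuclideanSpace ℂ (Fin m)) :
    fderiv ℝ (fderiv ℝ u) y a a +
      fderiv ℝ (fderiv ℝ u) y (Complex.I • a) (Complex.I • a) = 0 := by
  set D := fderiv ℝ (fderiv ℝ u) y with hD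
  have hij : ∀ i j : Fin m,
      D (EuclideanSpace.single i 1) (EuclideanSpace.single j 1) +
        D (EuclideanSpace.single i Complex.I) (EuclideanSpace.single j Complex.I) = 0 ∧
      D (EuclideanSpace.single i 1) (EuclideanSpace.single j Complex.I) -
        D (EuclideanSpace.single i Complex.I) (EuclideanSpace.single j 1) = 0 := by
    intro i j
    have h1 := h i j
    simp only [ddbar, iteratedFDeriv_two_apply, ← hD] at h1
    rw [mul_eq_zero_iff_left (by norm_num)] at h1
    have hre := congrArg Complex.re h1
    have him := congrArg Complex.im h1
    simp only [Complex.add_re, Complex.add_im, Complex.I_mul_re, Complex.I_mul_im,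
      Complex.ofReal_re, Complex.ofReal_im, Complex.zero_re, Complex.zero_im, neg_zero, add_zero,
      zero_add] at hre him
    exact ⟨hre, him⟩
  let q : EuclideanSpace ℂ (Fin m) →ₗ[ℝ] EuclideanSpace ℂ (Fin m) →ₗ[ℝ] ℝ :=
    LinearMap.mk₂ ℝ (fun a b => D a b + D (Complex.I • a) (Complex.I • b))
      (fun a a' b => by simp only [smul_add, map_add, add_apply]; ring)
      (fun c a b => by
        rw [smul_comm Complex.I c]
        simp only [map_smul, smul_apply, smul_eq_mul]; ring)
      (fun a b b' => by simp only [smul_add, map_add]; ring)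
      (fun c a b => by
        rw [smul_comm Complex.I c b]
        simp only [map_smul, smul_eq_mul]; ring)
  have hq : q = 0 := by
    refine LinearMap.ext_basis (realBasis m) (realBasis m) ?_
    have hI : ∀ k : Fin m, Complex.I • (EuclideanSpace.single k Complex.I : EuclideanSpace ℂ (Fin m))
        = -EuclideanSpace.single k 1 := by
      intro k
      rw [single_I, smul_smul, Complex.I_mul_I, neg_one_smul]
    rintro ⟨i, a⟩ ⟨j, b⟩
    rw [realBasis_eq]
    have e : ∀ a b, q a b = D a b + D (Complex.I • a) (Complex.I • b) := fun _ _ => rfl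
    rw [e]
    obtain ⟨h1, h2⟩ := hij i j
    fin_cases a <;> fin_cases b <;> simp only [realFrame, Fin.zero_eta, Fin.mk_one, if_true,
      one_ne_zero, if_false, Fin.isValue, hI, ← single_I, map_neg, neg_apply,
      LinearMap.zero_apply, neg_neg] <;> linarith
  exact LinearMap.congr_fun (LinearMap.congr_fun hq a) a

/-- A pluriharmonic function composed with a holomorphic curve is harmonic. -/
lemma harmonicAt_comp {m : ℕ} {u : EuclideanSpace ℂ (Fin m) → ℝ} {O : Set (EuclideanSpace ℂ (Fin m))}
    (hO : IsOpen O) (hu : ContDiffOn ℝ 2 u O) (h : ∀ y ∈ O, ∀ i j, ddbar u y i j = 0)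
    {γ : ℂ → EuclideanSpace ℂ (Fin m)} {V : Set ℂ} (hV : IsOpen V) (hγ : DifferentiableOn ℂ γ V)
    (hm : MapsTo γ V O) {ζ : ℂ} (hζ : ζ ∈ V) : HarmonicAt (u ∘ γ) ζ := by
  have hγa : ∀ x ∈ V, AnalyticAt ℂ γ x := fun x hx => hγ.analyticAt (hV.mem_nhds hx)
  have hua : ∀ y ∈ O, ContDiffAt ℝ 2 u y := fun y hy => hu.contDiffAt (hO.mem_nhds hy)
  refine ⟨(hua _ (hm hζ)).comp ζ (((hγa ζ hζ).contDiffAt (n := 2)).restrict_scalars ℝ), ?_⟩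
  filter_upwards [hV.mem_nhds hζ] with x hx
  rw [laplacian_eq_iteratedFDeriv_complexPlane]
  have hd1 : ∀ᶠ y in 𝓝 x, ∀ a : ℂ, fderiv ℝ (u ∘ γ) y a = fderiv ℝ u (γ y) (a • deriv γ y) := by
    filter_upwards [hV.mem_nhds hx] with y hy a
    have h1 : HasFDerivAt γ ((fderiv ℂ γ y).restrictScalars ℝ) y :=
      (hγa y hy).differentiableAt.hasFDerivAt.restrictScalars ℝ
    have h2 : HasFDerivAt u (fderiv ℝ u (γ y)) (γ y) :=
      ((hua _ (hm hy)).differentiableAt (by norm_num)).hasFDerivAt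
    rw [(h2.comp y h1).fderiv]
    simp [fderiv_eq_smul_deriv]
  -- Chain rule twice: the derivative of `γ` in the direction `a` is `a γ'`, which varies with
  -- derivative `a² γ''`.
  have hsecond : ∀ a : ℂ, iteratedFDeriv ℝ 2 (u ∘ γ) x ![a, a] =
      fderiv ℝ (fderiv ℝ u) (γ x) (a • deriv γ x) (a • deriv γ x) +
        fderiv ℝ u (γ x) ((a * a) • deriv (deriv γ) x) := by
    intro a
    rw [iteratedFDeriv_two_apply]
    simp only [Matrix.cons_val_zero, Matrix.cons_val_one]
    have hdd : DifferentiableAt ℝ (fderiv ℝ (u ∘ γ)) x := by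
      have : ContDiffAt ℝ 2 (u ∘ γ) x :=
        (hua _ (hm hx)).comp x (((hγa x hx).contDiffAt (n := 2)).restrict_scalars ℝ)
      exact (this.fderiv_right (m := 1) (by norm_num)).differentiableAt (by norm_num)
    have e1 : fderiv ℝ (fderiv ℝ (u ∘ γ)) x a a = fderiv ℝ (fun y => fderiv ℝ (u ∘ γ) y a) x a := by
      rw [fderiv_clm_apply hdd (differentiableAt_const a)]
      simp
    have e2 : (fun y => fderiv ℝ (u ∘ γ) y a) =ᶠ[𝓝 x] fun y => fderiv ℝ u (γ y) (a • deriv γ y) :=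
      hd1.mono fun y hy => hy a
    rw [e1, e2.fderiv_eq]
    have h1 : HasFDerivAt γ ((fderiv ℂ γ x).restrictScalars ℝ) x :=
      (hγa x hx).differentiableAt.hasFDerivAt.restrictScalars ℝ
    have h2 : HasFDerivAt (fderiv ℝ u) (fderiv ℝ (fderiv ℝ u) (γ x)) (γ x) :=
      (((hua _ (hm hx)).fderiv_right (m := 1) (by norm_num)).differentiableAt
        (by norm_num)).hasFDerivAt
    have h3 : HasFDerivAt (fun y => a • deriv γ y)
        (a • (fderiv ℂ (deriv γ) x).restrictScalars ℝ) x :=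
      ((hγa x hx).deriv.differentiableAt.hasFDerivAt.restrictScalars ℝ).const_smul a
    have h4 := (h2.comp x h1).clm_apply h3
    simp only [Function.comp_apply] at h4
    rw [h4.fderiv]
    simp [fderiv_eq_smul_deriv, mul_smul, add_comm]
  dsimp only
  rw [hsecond, hsecond]
  have hq := fderiv_fderiv_add_eq_zero (h _ (hm hx)) (deriv γ x)
  -- The terms in `γ''` cancel between `a = 1` and `a = i`. What remains is `D²u(γ', γ') + D²u(i γ',
  -- i γ') = 0`.
  simp only [one_smul, mul_one, Complex.I_mul_I, neg_smul, map_neg, Pi.zero_apply]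
  linarith

end Pluriharmonic

/-! ### Kähler forms in holomorphic coordinates -/

section PullForm

open Set Filter

variable {m : ℕ} {X : Type*} [TopologicalSpace X] [ChartedSpace (EuclideanSpace ℂ (Fin m)) X]

/-- All tangent spaces are definitionally the model space, so forms at two equal base points can be
compared without a cast. -/
lemma compContinuousLinearMap_congr
    (form : ∀ p : X, TangentSpace 𝓘(ℂ, EuclideanSpace ℂ (Fin m)) p [⋀^Fin 2]→L[ℝ] ℝ) {p q : X}
    (h : p = q) (A : EuclideanSpace ℂ (Fin m) →L[ℂ] EuclideanSpace ℂ (Fin m)) :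
    ((form p).compContinuousLinearMap (A.restrictScalars ℝ) :
      EuclideanSpace ℂ (Fin m) [⋀^Fin 2]→L[ℝ] ℝ) =
      (form q).compContinuousLinearMap (A.restrictScalars ℝ) := by
  subst h
  rfl

lemma pullForm_congr
    (form : ∀ p : X, TangentSpace 𝓘(ℂ, EuclideanSpace ℂ (Fin m)) p [⋀^Fin 2]→L[ℝ] ℝ)
    {f f' : EuclideanSpace ℂ (Fin m) → X} {z : EuclideanSpace ℂ (Fin m)} (h : f =ᶠ[𝓝 z] f') :
    pullForm form f z = pullForm form f' z := by
  have h1 : (mfderiv 𝓘(ℂ, EuclideanSpace ℂ (Fin m)) 𝓘(ℂ, EuclideanSpace ℂ (Fin m)) f z :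
      EuclideanSpace ℂ (Fin m) →L[ℂ] EuclideanSpace ℂ (Fin m)) =
      mfderiv 𝓘(ℂ, EuclideanSpace ℂ (Fin m)) 𝓘(ℂ, EuclideanSpace ℂ (Fin m)) f' z := h.mfderiv_eq
  have h2 := compContinuousLinearMap_congr form h.eq_of_nhds
    (mfderiv 𝓘(ℂ, EuclideanSpace ℂ (Fin m)) 𝓘(ℂ, EuclideanSpace ℂ (Fin m)) f z)
  refine Eq.trans h2 ?_
  rw [h1]
  rfl

lemma pullForm_comp
    (form : ∀ p : X, TangentSpace 𝓘(ℂ, EuclideanSpace ℂ (Fin m)) p [⋀^Fin 2]→L[ℝ] ℝ)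
    {f : EuclideanSpace ℂ (Fin m) → X} {g : EuclideanSpace ℂ (Fin m) → EuclideanSpace ℂ (Fin m)}
    {z : EuclideanSpace ℂ (Fin m)}
    (hf : MDifferentiableAt 𝓘(ℂ, EuclideanSpace ℂ (Fin m)) 𝓘(ℂ, EuclideanSpace ℂ (Fin m)) f (g z))
    (hg : DifferentiableAt ℂ g z) :
    pullForm form (f ∘ g) z =
      (pullForm form f (g z)).compContinuousLinearMap ((fderiv ℂ g z).restrictScalars ℝ) := by
  have h1 : (mfderiv 𝓘(ℂ, EuclideanSpace ℂ (Fin m)) 𝓘(ℂ, EuclideanSpace ℂ (Fin m)) (f ∘ g) z :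
      EuclideanSpace ℂ (Fin m) →L[ℂ] EuclideanSpace ℂ (Fin m)) =
      (mfderiv 𝓘(ℂ, EuclideanSpace ℂ (Fin m)) 𝓘(ℂ, EuclideanSpace ℂ (Fin m)) f (g z)).comp
        (fderiv ℂ g z) := by
    rw [mfderiv_comp z hf hg.mdifferentiableAt, mfderiv_eq_fderiv]
    rfl
  have h2 : pullForm form (f ∘ g) z = ((form (f (g z))).compContinuousLinearMap
      ((mfderiv 𝓘(ℂ, EuclideanSpace ℂ (Fin m)) 𝓘(ℂ, EuclideanSpace ℂ (Fin m)) (f ∘ g) z :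
      EuclideanSpace ℂ (Fin m) →L[ℂ] EuclideanSpace ℂ (Fin m)).restrictScalars ℝ) :
      EuclideanSpace ℂ (Fin m) [⋀^Fin 2]→L[ℝ] ℝ) := rfl
  rw [h2, h1]
  rfl

lemma pullForm_apply
    (form : ∀ p : X, TangentSpace 𝓘(ℂ, EuclideanSpace ℂ (Fin m)) p [⋀^Fin 2]→L[ℝ] ℝ)
    (f : EuclideanSpace ℂ (Fin m) → X) (z v w : EuclideanSpace ℂ (Fin m)) :
    pullForm form f z ![v, w] = form (f z)
      ![mfderiv 𝓘(ℂ, EuclideanSpace ℂ (Fin m)) 𝓘(ℂ, EuclideanSpace ℂ (Fin m)) f z v,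
        mfderiv 𝓘(ℂ, EuclideanSpace ℂ (Fin m)) 𝓘(ℂ, EuclideanSpace ℂ (Fin m)) f z w] := by
  rw [pullForm]
  refine Eq.trans (ContinuousAlternatingMap.compContinuousLinearMap_apply _ _ _) ?_
  congr 1
  ext i
  fin_cases i <;> rfl

lemma KahlerForm.isPositive_pullForm (η : KahlerForm m X) {f : EuclideanSpace ℂ (Fin m) → X}
    {z : EuclideanSpace ℂ (Fin m)}
    (hf : Function.Injective
      (mfderiv 𝓘(ℂ, EuclideanSpace ℂ (Fin m)) 𝓘(ℂ, EuclideanSpace ℂ (Fin m)) f z)) :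
    IsPositive (pullForm η.form f z) := by
  refine ⟨fun v w => ?_, fun v hv => ?_⟩
  · rw [pullForm_apply, pullForm_apply]
    refine Eq.trans ?_ (η.invariant (f z) _ _)
    congr 2
    · exact ContinuousLinearMap.map_smul _ _ _
    · congr 1
      exact ContinuousLinearMap.map_smul _ _ _
  · rw [pullForm_apply]
    refine lt_of_lt_of_eq (η.positive (f z)
      (mfderiv 𝓘(ℂ, EuclideanSpace ℂ (Fin m)) 𝓘(ℂ, EuclideanSpace ℂ (Fin m)) f z v) ?_) ?_
    · intro h0
      exact hv (hf (h0.trans (ContinuousLinearMap.map_zero _).symm))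
    · congr 2
      congr 1
      exact (ContinuousLinearMap.map_smul _ _ _).symm

lemma mfderiv_injective_of_leftInverse {f : EuclideanSpace ℂ (Fin m) → X}
    {g : X → EuclideanSpace ℂ (Fin m)} {z : EuclideanSpace ℂ (Fin m)}
    (hf : MDifferentiableAt 𝓘(ℂ, EuclideanSpace ℂ (Fin m)) 𝓘(ℂ, EuclideanSpace ℂ (Fin m)) f z)
    (hg : MDifferentiableAt 𝓘(ℂ, EuclideanSpace ℂ (Fin m)) 𝓘(ℂ, EuclideanSpace ℂ (Fin m)) g (f z))
    (h : ∀ᶠ x in 𝓝 z, g (f x) = x) : Function.Injective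
      (mfderiv 𝓘(ℂ, EuclideanSpace ℂ (Fin m)) 𝓘(ℂ, EuclideanSpace ℂ (Fin m)) f z) := by
  have h1 : mfderiv 𝓘(ℂ, EuclideanSpace ℂ (Fin m)) 𝓘(ℂ, EuclideanSpace ℂ (Fin m)) (g ∘ f) z =
      mfderiv 𝓘(ℂ, EuclideanSpace ℂ (Fin m)) 𝓘(ℂ, EuclideanSpace ℂ (Fin m)) id z :=
    Filter.EventuallyEq.mfderiv_eq h
  rw [mfderiv_id, mfderiv_comp z hg hf] at h1
  intro v w hvw
  have hv := DFunLike.congr_fun h1 v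
  have hw := DFunLike.congr_fun h1 w
  refine hv.symm.trans (Eq.trans ?_ hw)
  exact congrArg (mfderiv 𝓘(ℂ, EuclideanSpace ℂ (Fin m)) 𝓘(ℂ, EuclideanSpace ℂ (Fin m)) g (f z)) hvw

variable [IsManifold 𝓘(ℂ, EuclideanSpace ℂ (Fin m)) ω X]

lemma mfderiv_chart_symm_injective {e : OpenPartialHomeomorph X (EuclideanSpace ℂ (Fin m))}
    (he : e ∈ atlas (EuclideanSpace ℂ (Fin m)) X) {y : EuclideanSpace ℂ (Fin m)}
    (hy : y ∈ e.target) : Function.Injective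
      (mfderiv 𝓘(ℂ, EuclideanSpace ℂ (Fin m)) 𝓘(ℂ, EuclideanSpace ℂ (Fin m)) e.symm y) :=
  mfderiv_injective_of_leftInverse (mdifferentiableAt_atlas_symm he hy)
    (mdifferentiableAt_atlas he (e.map_target hy)) (e.eventually_right_inverse hy)

lemma KahlerForm.isPositive_chart (η : KahlerForm m X)
    {e : OpenPartialHomeomorph X (EuclideanSpace ℂ (Fin m))}
    (he : e ∈ atlas (EuclideanSpace ℂ (Fin m)) X) {y : EuclideanSpace ℂ (Fin m)}
    (hy : y ∈ e.target) : IsPositive (pullForm η.form e.symm y) :=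
  η.isPositive_pullForm (mfderiv_chart_symm_injective he hy)

lemma differentiableAt_chart_comp {e : OpenPartialHomeomorph X (EuclideanSpace ℂ (Fin m))}
    (he : e ∈ atlas (EuclideanSpace ℂ (Fin m)) X) {f : EuclideanSpace ℂ (Fin m) → X}
    {z : EuclideanSpace ℂ (Fin m)}
    (hf : MDifferentiableAt 𝓘(ℂ, EuclideanSpace ℂ (Fin m)) 𝓘(ℂ, EuclideanSpace ℂ (Fin m)) f z)
    (hz : f z ∈ e.source) : DifferentiableAt ℂ (e ∘ f) z :=
  ((mdifferentiableAt_atlas he hz).comp z hf).differentiableAt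

lemma pullForm_eq_chart
    (form : ∀ p : X, TangentSpace 𝓘(ℂ, EuclideanSpace ℂ (Fin m)) p [⋀^Fin 2]→L[ℝ] ℝ)
    {e : OpenPartialHomeomorph X (EuclideanSpace ℂ (Fin m))}
    (he : e ∈ atlas (EuclideanSpace ℂ (Fin m)) X) {f : EuclideanSpace ℂ (Fin m) → X}
    {z : EuclideanSpace ℂ (Fin m)}
    (hf : MDifferentiableAt 𝓘(ℂ, EuclideanSpace ℂ (Fin m)) 𝓘(ℂ, EuclideanSpace ℂ (Fin m)) f z)
    (hz : f z ∈ e.source) :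
    pullForm form f z = (pullForm form e.symm (e (f z))).compContinuousLinearMap
      ((fderiv ℂ (e ∘ f) z).restrictScalars ℝ) := by
  have h : f =ᶠ[𝓝 z] e.symm ∘ (e ∘ f) := by
    filter_upwards [hf.continuousAt.preimage_mem_nhds (e.open_source.mem_nhds hz)] with x hx
    exact (e.left_inv hx).symm
  rw [pullForm_congr form h]
  exact pullForm_comp form (mdifferentiableAt_atlas_symm he (e.map_source hz))
    (differentiableAt_chart_comp he hf hz)

lemma density_pullForm_eq_chart
    (form : ∀ p : X, TangentSpace 𝓘(ℂ, EuclideanSpace ℂ (Fin m)) p [⋀^Fin 2]→L[ℝ] ℝ)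
    {e : OpenPartialHomeomorph X (EuclideanSpace ℂ (Fin m))}
    (he : e ∈ atlas (EuclideanSpace ℂ (Fin m)) X) {f : EuclideanSpace ℂ (Fin m) → X}
    {z : EuclideanSpace ℂ (Fin m)}
    (hf : MDifferentiableAt 𝓘(ℂ, EuclideanSpace ℂ (Fin m)) 𝓘(ℂ, EuclideanSpace ℂ (Fin m)) f z)
    (hz : f z ∈ e.source) :
    density (pullForm form f z) =
      ‖(fderiv ℂ (e ∘ f) z).det‖ ^ 2 * density (pullForm form e.symm (e (f z))) := by
  rw [pullForm_eq_chart form he hf hz, density_comp]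

/-- The local potential `log det (h_{k l̄})` of the Ricci form in a chart is smooth. -/
lemma KahlerForm.contDiffOn_log_det (η : KahlerForm m X)
    {e : OpenPartialHomeomorph X (EuclideanSpace ℂ (Fin m))}
    (he : e ∈ atlas (EuclideanSpace ℂ (Fin m)) X) :
    ContDiffOn ℝ 2
      (fun w => Real.log (hermitianMatrix (pullForm η.form e.symm w)).det.re) e.target := by
  have h0 : ContDiffOn ℝ 2 (pullForm η.form e.symm) e.target :=
    (η.smooth e he).of_le (WithTop.coe_le_coe.mpr (le_top : (2 : ℕ∞) ≤ ⊤))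
  have h1 : ∀ v : Fin 2 → EuclideanSpace ℂ (Fin m),
      ContDiffOn ℝ 2 (fun w => ((pullForm η.form e.symm w v : ℝ) : ℂ)) e.target := by
    intro v
    exact Complex.ofRealCLM.contDiff.comp_contDiffOn
      ((ContinuousAlternatingMap.apply ℝ (EuclideanSpace ℂ (Fin m)) ℝ v).contDiff.comp_contDiffOn h0)
  have h2 : ∀ i j, ContDiffOn ℝ 2 (fun w => hermitianMatrix (pullForm η.form e.symm w) i j)
      e.target := by
    intro i j
    simp only [hermitianMatrix, Matrix.of_apply]
    exact contDiffOn_const.mul ((h1 _).sub (contDiffOn_const.mul (h1 _)))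
  have h3 : ContDiffOn ℝ 2 (fun w => (hermitianMatrix (pullForm η.form e.symm w)).det) e.target := by
    simp only [Matrix.det_apply]
    exact ContDiffOn.sum fun σ _ => (contDiffOn_prod fun i _ => h2 _ _).const_smul _
  exact ContDiffOn.log (Complex.reCLM.contDiff.comp_contDiffOn h3)
    fun y hy => (η.isPositive_chart he hy).det_pos.ne'

end PullForm

/-! ### The volume form of a Ricci-flat ALE metric -/

section Resolution

open Set Filter InnerProductSpace

variable {m : ℕ} {Γ : Subgroup (EuclideanSpace ℂ (Fin m) ≃ₗᵢ[ℂ] EuclideanSpace ℂ (Fin m))}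

/-! ### The quotient map and the holomorphic inverse of the resolution. -/

lemma proj_eq_proj_iff {z w : EuclideanSpace ℂ (Fin m)} :
    proj Γ z = proj Γ w ↔ ∃ γ ∈ Γ, γ z = w := Quotient.eq (r := orbitSetoid Γ)

lemma proj_eq_zero_iff {z : EuclideanSpace ℂ (Fin m)} : proj Γ z = proj Γ 0 ↔ z = 0 := by
  rw [proj_eq_proj_iff]
  constructor
  · rintro ⟨γ, -, h⟩
    exact (map_eq_zero_iff γ γ.injective).mp h
  · rintro rfl
    exact ⟨1, Γ.one_mem, map_zero _⟩

variable {X : Type*} [TopologicalSpace X] [ChartedSpace (EuclideanSpace ℂ (Fin m)) X] [Nonempty X]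
  {π : X → QuotientSpace Γ}

namespace IsResolution

lemma proj_inverseLift (hπ : IsResolution Γ π) {z : EuclideanSpace ℂ (Fin m)} (hz : z ≠ 0) :
    π (inverseLift Γ π z) = proj Γ z := by
  obtain ⟨p, -, hp⟩ := hπ.bijOn.surjOn (show proj Γ z ∈ {proj Γ 0}ᶜ from fun h =>
    hz (proj_eq_zero_iff.mp h))
  exact Function.invFun_eq ⟨p, hp⟩

lemma inverseLift_eq (hπ : IsResolution Γ π) {p : X} {z : EuclideanSpace ℂ (Fin m)}
    (hz : z ≠ 0) (h : proj Γ z = π p) : inverseLift Γ π z = p := by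
  have h1 := hπ.proj_inverseLift hz
  have h2 : proj Γ z ≠ proj Γ 0 := fun h0 => hz (proj_eq_zero_iff.mp h0)
  exact hπ.bijOn.injOn (show π _ ≠ _ by rwa [h1]) (show π p ≠ _ by rwa [← h]) (h1.trans h)

omit [TopologicalSpace X] [ChartedSpace (EuclideanSpace ℂ (Fin m)) X] [Nonempty X] in
lemma lift_ne_zero {p : X} {z : EuclideanSpace ℂ (Fin m)} (hp : π p ≠ proj Γ 0)
    (h : proj Γ z = π p) : z ≠ 0 := by
  rintro rfl
  exact hp h.symm

lemma mdifferentiableAt_inverseLift (hπ : IsResolution Γ π) {z : EuclideanSpace ℂ (Fin m)}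
    (hz : z ≠ 0) : MDifferentiableAt 𝓘(ℂ, EuclideanSpace ℂ (Fin m))
      𝓘(ℂ, EuclideanSpace ℂ (Fin m)) (inverseLift Γ π) z :=
  (hπ.holomorphic_inverse z hz).mdifferentiableAt (isOpen_compl_singleton.mem_nhds hz)

end IsResolution

lemma isOpen_ne_zero (hπ : IsResolution Γ π) : IsOpen {p : X | π p ≠ proj Γ 0} := by
  have h : IsOpen ({proj Γ 0}ᶜ : Set (QuotientSpace Γ)) := by
    rw [← isQuotientMap_quotient_mk'.isOpen_preimage]
    have : Quotient.mk' (s := orbitSetoid Γ) ⁻¹' {proj Γ 0}ᶜ = {0}ᶜ := by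
      ext z
      exact not_congr proj_eq_zero_iff
    exact this ▸ isOpen_compl_singleton
  exact h.preimage hπ.proper.continuous

/-- Near a point off the exceptional set, a local lift is a section of `inverseLift`. -/
lemma eventually_inverseLift_lift (hπ : IsResolution Γ π) {p : X} (hp : π p ≠ proj Γ 0) {U : Set X}
    {f : X → EuclideanSpace ℂ (Fin m)} (hpU : p ∈ U) (hf : IsLocalLift Γ π U f) :
    ∀ᶠ q in 𝓝 p, inverseLift Γ π (f q) = q := by
  filter_upwards [hf.1.mem_nhds hpU, (isOpen_ne_zero hπ).mem_nhds hp] with q hq hq0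
  exact hπ.inverseLift_eq (IsResolution.lift_ne_zero hq0 (hf.2.2 q hq)) (hf.2.2 q hq)

omit [Nonempty X] in
lemma mdifferentiableAt_lift {p : X} {U : Set X} {f : X → EuclideanSpace ℂ (Fin m)} (hpU : p ∈ U)
    (hf : IsLocalLift Γ π U f) : MDifferentiableAt 𝓘(ℂ, EuclideanSpace ℂ (Fin m))
      𝓘(ℂ, EuclideanSpace ℂ (Fin m)) f p :=
  (hf.2.1 p hpU).mdifferentiableAt (hf.1.mem_nhds hpU)

/-- `mfderiv f p` is a right inverse of the derivative of `inverseLift`. -/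
lemma mfderiv_inverseLift_comp (hπ : IsResolution Γ π) {p : X} (hp : π p ≠ proj Γ 0) {U : Set X}
    {f : X → EuclideanSpace ℂ (Fin m)} (hpU : p ∈ U) (hf : IsLocalLift Γ π U f)
    (v : EuclideanSpace ℂ (Fin m)) :
    (mfderiv 𝓘(ℂ, EuclideanSpace ℂ (Fin m)) 𝓘(ℂ, EuclideanSpace ℂ (Fin m)) (inverseLift Γ π) (f p) :
      EuclideanSpace ℂ (Fin m) →L[ℂ] EuclideanSpace ℂ (Fin m))
      (mfderiv 𝓘(ℂ, EuclideanSpace ℂ (Fin m)) 𝓘(ℂ, EuclideanSpace ℂ (Fin m)) f p v) = v := by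
  have h0 : f p ≠ 0 := IsResolution.lift_ne_zero hp (hf.2.2 p hpU)
  have h1 : mfderiv 𝓘(ℂ, EuclideanSpace ℂ (Fin m)) 𝓘(ℂ, EuclideanSpace ℂ (Fin m))
      (inverseLift Γ π ∘ f) p =
      mfderiv 𝓘(ℂ, EuclideanSpace ℂ (Fin m)) 𝓘(ℂ, EuclideanSpace ℂ (Fin m)) id p :=
    Filter.EventuallyEq.mfderiv_eq (eventually_inverseLift_lift hπ hp hpU hf)
  rw [mfderiv_id, mfderiv_comp p (hπ.mdifferentiableAt_inverseLift h0)
    (mdifferentiableAt_lift hpU hf)] at h1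
  exact DFunLike.congr_fun h1 v

/-- A local lift gives the derivative of `inverseLift` a right inverse, so by equality of dimensions
it is bijective. The lift may return another point of the orbit of `z`, and the invariance of
`inverseLift` under `Γ` carries the result back to `z`. -/
lemma mfderiv_inverseLift_injective (hπ : IsResolution Γ π) {z : EuclideanSpace ℂ (Fin m)}
    (hz : z ≠ 0) : Function.Injective (mfderiv 𝓘(ℂ, EuclideanSpace ℂ (Fin m))
      𝓘(ℂ, EuclideanSpace ℂ (Fin m)) (inverseLift Γ π) z) := by
  have hp : π (inverseLift Γ π z) ≠ proj Γ 0 := by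
    rw [hπ.proj_inverseLift hz]
    exact fun h0 => hz (proj_eq_zero_iff.mp h0)
  obtain ⟨U, f, hpU, hf⟩ := hπ.exists_lift _ hp
  obtain ⟨γ, hγ, hγz⟩ := proj_eq_proj_iff.mp
    ((hf.2.2 _ hpU).trans (hπ.proj_inverseLift hz))
  set A : EuclideanSpace ℂ (Fin m) →L[ℂ] EuclideanSpace ℂ (Fin m) :=
    mfderiv 𝓘(ℂ, EuclideanSpace ℂ (Fin m)) 𝓘(ℂ, EuclideanSpace ℂ (Fin m)) (inverseLift Γ π)
      (f (inverseLift Γ π z)) with hA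
  have hAsurj : Function.Surjective A := fun v =>
    ⟨_, mfderiv_inverseLift_comp hπ hp hpU hf v⟩
  have hAinj : Function.Injective A :=
    (LinearMap.injective_iff_surjective (f := (A : EuclideanSpace ℂ (Fin m) →ₗ[ℂ] _))).mpr hAsurj
  have hf0 : f (inverseLift Γ π z) ≠ 0 := IsResolution.lift_ne_zero hp (hf.2.2 _ hpU)
  have hinv : inverseLift Γ π = inverseLift Γ π ∘ γ := by
    ext x
    simp only [Function.comp_apply, inverseLift]
    congr 1
    exact proj_eq_proj_iff.mpr ⟨γ, hγ, rfl⟩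
  have hinv' : inverseLift Γ π = inverseLift Γ π ∘ γ.symm := by
    conv_rhs => rw [hinv]
    ext x
    simp
  have hγz' : γ.symm z = f (inverseLift Γ π z) := 
    γ.injective (by rw [γ.apply_symm_apply, hγz])
  have hγd : DifferentiableAt ℂ γ.symm z := γ.symm.toContinuousLinearEquiv.differentiableAt
  have hB : (mfderiv 𝓘(ℂ, EuclideanSpace ℂ (Fin m)) 𝓘(ℂ, EuclideanSpace ℂ (Fin m))
      (inverseLift Γ π) z : EuclideanSpace ℂ (Fin m) →L[ℂ] EuclideanSpace ℂ (Fin m)) =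
      A.comp (fderiv ℂ γ.symm z) := by
    conv_lhs => rw [hinv']
    rw [mfderiv_comp z (hγz'.symm ▸ hπ.mdifferentiableAt_inverseLift hf0) hγd.mdifferentiableAt,
      mfderiv_eq_fderiv, hA, ← hγz']
    rfl
  have hfd : fderiv ℂ γ.symm z = (γ.symm.toContinuousLinearEquiv : _ →L[ℂ] _) :=
    γ.symm.toContinuousLinearEquiv.fderiv
  have : Function.Injective (A.comp (fderiv ℂ γ.symm z)) := by
    rw [hfd]
    exact hAinj.comp γ.symm.injective
  rw [← hB] at this
  exact this

lemma continuousOn_inverseLift (hπ : IsResolution Γ π) : ContinuousOn (inverseLift Γ π) {0}ᶜ :=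
  fun _ hz => (hπ.mdifferentiableAt_inverseLift hz).continuousAt.continuousWithinAt

lemma isPositive_pullForm_inverseLift (hπ : IsResolution Γ π) (η : KahlerForm m X)
    {z : EuclideanSpace ℂ (Fin m)} (hz : z ≠ 0) :
    IsPositive (pullForm η.form (inverseLift Γ π) z) :=
  η.isPositive_pullForm (mfderiv_inverseLift_injective hπ hz)

/-- The determinant is polynomial in directional derivatives, each holomorphic along complex lines.
-/
lemma differentiableOn_det_fderiv_line {g : EuclideanSpace ℂ (Fin m) → EuclideanSpace ℂ (Fin m)}
    {U : Set (EuclideanSpace ℂ (Fin m))} (hU : IsOpen U) (hg : DifferentiableOn ℂ g U)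
    (z w : EuclideanSpace ℂ (Fin m)) :
    DifferentiableOn ℂ (fun ζ : ℂ => (fderiv ℂ g (z + ζ • w)).det) {ζ | z + ζ • w ∈ U} := by
  have h1 : ∀ A : EuclideanSpace ℂ (Fin m) →L[ℂ] EuclideanSpace ℂ (Fin m),
      A.det = (Matrix.of fun i j => A (EuclideanSpace.single j 1) i).det := by
    intro A
    rw [ContinuousLinearMap.det, ← LinearMap.det_toMatrix (PiLp.basisFun 2 ℂ (Fin m))]
    congr 1
  simp only [h1, Matrix.det_apply]
  refine DifferentiableOn.fun_sum fun σ _ => DifferentiableOn.const_smul ?_ _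
  refine DifferentiableOn.fun_finsetProd fun i _ => ?_
  have h2 := differentiableOn_fderiv_line hU hg z w (EuclideanSpace.single i 1)
  exact (EuclideanSpace.proj (𝕜 := ℂ) (σ i)).differentiable.comp_differentiableOn h2

/-! ### Harmonicity of `log det h` along complex lines and Liouville's theorem. -/

variable [IsManifold 𝓘(ℂ, EuclideanSpace ℂ (Fin m)) ω X]

/-- Near a point, `log det h` is `2 log |det D(e ∘ φ)|` plus the Ricci potential of the chart `e`
along a holomorphic curve. Both summands are harmonic in `ζ`. -/
lemma harmonicAt_log_det_line (hπ : IsResolution Γ π) (η : KahlerForm m X) (hRic : η.RicciFlat)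
    (z w : EuclideanSpace ℂ (Fin m)) {ζ₀ : ℂ} (h0 : z + ζ₀ • w ≠ 0) :
    HarmonicAt (fun ζ : ℂ => Real.log
      (hermitianMatrix (pullForm η.form (inverseLift Γ π) (z + ζ • w))).det.re) ζ₀ := by
  set φ := inverseLift Γ π with hφ
  set e := chartAt (EuclideanSpace ℂ (Fin m)) (φ (z + ζ₀ • w)) with he'
  have he : e ∈ atlas (EuclideanSpace ℂ (Fin m)) X := chart_mem_atlas _ _
  set U : Set (EuclideanSpace ℂ (Fin m)) := {0}ᶜ ∩ φ ⁻¹' e.source with hUdef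
  have hU : IsOpen U :=
    (continuousOn_inverseLift hπ).isOpen_inter_preimage isOpen_compl_singleton e.open_source
  have hx₀ : z + ζ₀ • w ∈ U := ⟨h0, mem_chart_source _ _⟩
  have hg : DifferentiableOn ℂ (e ∘ φ) U := fun x hx =>
    (differentiableAt_chart_comp he (hπ.mdifferentiableAt_inverseLift hx.1)
      hx.2).differentiableWithinAt
  have hline : Continuous fun ζ : ℂ => z + ζ • w := by fun_prop
  set V : Set ℂ := {ζ | z + ζ • w ∈ U} with hV
  have hVo : IsOpen V := hU.preimage hline
  have hdens : ∀ x ∈ U, ‖(fderiv ℂ (e ∘ φ) x).det‖ ^ 2 *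
      (hermitianMatrix (pullForm η.form e.symm (e (φ x)))).det.re =
      (hermitianMatrix (pullForm η.form φ x)).det.re := by
    intro x hx
    have h1 := density_pullForm_eq_chart η.form he (hπ.mdifferentiableAt_inverseLift hx.1) hx.2
    rw [(isPositive_pullForm_inverseLift hπ η hx.1).density_eq,
      (η.isPositive_chart he (e.map_source hx.2)).density_eq, mul_left_comm] at h1
    exact (mul_left_cancel₀ (by positivity) h1).symm
  -- The Jacobian cannot vanish, since `det h` would vanish with it, against positivity.
  have hdet : ∀ x ∈ U, (fderiv ℂ (e ∘ φ) x).det ≠ 0 := by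
    intro x hx h0
    have h1 := hdens x hx
    rw [h0, norm_zero, zero_pow two_ne_zero, zero_mul] at h1
    exact (isPositive_pullForm_inverseLift hπ η hx.1).det_pos.ne h1
  have hD := differentiableOn_det_fderiv_line hU hg z w
  have hharm1 : HarmonicAt (fun ζ : ℂ => Real.log ‖(fderiv ℂ (e ∘ φ) (z + ζ • w)).det‖) ζ₀ :=
    (hD.analyticAt (hVo.mem_nhds hx₀)).harmonicAt_log_norm (hdet _ hx₀)
  have hharm2 := harmonicAt_comp e.open_target (η.contDiffOn_log_det he)
    (fun y hy i j => neg_eq_zero.mp (hRic e he y hy i j)) (γ := fun ζ => e (φ (z + ζ • w))) hVo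
    (fun ζ hζ => by
      have h4 : DifferentiableAt ℂ (fun ζ : ℂ => z + ζ • w) ζ := by fun_prop
      exact ((hg.differentiableAt (hU.mem_nhds hζ)).comp ζ h4).differentiableWithinAt)
    (fun ζ hζ => e.map_source hζ.2) hx₀
  refine (harmonicAt_congr_nhds ?_).mpr ((hharm1.const_smul (c := (2 : ℝ))).add hharm2)
  filter_upwards [hVo.mem_nhds hx₀] with ζ hζ
  rw [← hdens _ hζ, Real.log_mul (pow_ne_zero _ (norm_ne_zero_iff.mpr (hdet _ hζ)))
    (η.isPositive_chart he (e.map_source hζ.2)).det_pos.ne', Real.log_pow]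
  simp

omit [IsManifold 𝓘(ℂ, EuclideanSpace ℂ (Fin m)) ω X] in
-- Only the decay of order zero enters; the decay of the derivatives plays no role.
lemma tendsto_det_of_isALE {η : KahlerForm m X} (hALE : IsALE Γ π η) :
    Tendsto (fun x => (hermitianMatrix (pullForm η.form (inverseLift Γ π) x)).det.re)
      (Bornology.cobounded (EuclideanSpace ℂ (Fin m))) (𝓝 ((1 / 2) ^ m)) := by
  obtain ⟨τ, hτ, h⟩ := hALE
  have hdecay : Tendsto (fun x : EuclideanSpace ℂ (Fin m) => ‖x‖ ^ (-τ - ((0 : ℕ) : ℝ)))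
      (Bornology.cobounded _) (𝓝 0) := by
    simp only [Nat.cast_zero, sub_zero]
    exact (tendsto_rpow_neg_atTop hτ).comp tendsto_norm_cobounded_atTop
  have hentry : ∀ i j, Tendsto
      (fun x => hermitianMatrix (pullForm η.form (inverseLift Γ π) x) i j)
      (Bornology.cobounded (EuclideanSpace ℂ (Fin m)))
      (𝓝 (((1 / 2 : ℂ) • (1 : Matrix (Fin m) (Fin m) ℂ)) i j)) := by
    intro i j
    have h1 := (h i j 0).trans_tendsto hdecay
    rw [tendsto_zero_iff_norm_tendsto_zero] at h1
    simp only [norm_iteratedFDeriv_zero] at h1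
    rw [← tendsto_zero_iff_norm_tendsto_zero] at h1
    rw [Matrix.smul_apply, smul_eq_mul]
    exact tendsto_sub_nhds_zero_iff.mp h1
  have hmat : Tendsto (fun x => hermitianMatrix (pullForm η.form (inverseLift Γ π) x))
      (Bornology.cobounded (EuclideanSpace ℂ (Fin m)))
      (𝓝 ((1 / 2 : ℂ) • (1 : Matrix (Fin m) (Fin m) ℂ))) :=
    tendsto_pi_nhds.mpr fun i => tendsto_pi_nhds.mpr fun j => hentry i j
  have hc : Continuous fun M : Matrix (Fin m) (Fin m) ℂ => M.det.re :=
    Complex.continuous_re.comp (Continuous.matrix_det continuous_id)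
  have := (hc.tendsto _).comp hmat
  rw [Matrix.det_smul, Matrix.det_one, Fintype.card_fin, mul_one,
    show (1 / 2 : ℂ) ^ m = (((1 / 2 : ℝ) ^ m : ℝ) : ℂ) by push_cast; rfl, Complex.ofReal_re] at this
  exact this

/-- A harmonic function on `ℂ` with a limit at infinity is constant. -/
lemma eq_of_harmonic_of_tendsto {f : ℂ → ℝ} (hf : ∀ ζ, HarmonicAt f ζ) {c : ℝ}
    (hc : Tendsto f (Bornology.cobounded ℂ) (𝓝 c)) (ζ : ℂ) : f ζ = c := by
  have hcont : Continuous f :=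
    continuous_iff_continuousAt.mpr fun ζ => (hf ζ).1.continuousAt
  -- The limit bounds `f` near infinity and continuity bounds it on the remaining compact set, so
  -- Liouville's theorem for bounded harmonic functions applies.
  have hb : Bornology.IsBounded (range f) := by
    rw [Metric.cobounded_eq_cocompact] at hc
    obtain ⟨s, hs, hsb⟩ := Metric.exists_isBounded_image_of_tendsto hc
    obtain ⟨t, ht, hts⟩ := mem_cocompact.mp hs
    refine ((ht.image hcont).isBounded.union hsb).subset ?_
    rintro _ ⟨x, rfl⟩
    by_cases hx : x ∈ t
    · exact Or.inl ⟨x, hx, rfl⟩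
    · exact Or.inr ⟨x, hts hx, rfl⟩
  have h := bounded_harmonic_on_complex_plane_is_constant f (fun ζ _ => hf ζ) hb
  have : f = fun _ => f ζ := funext fun x => h x ζ
  rw [this] at hc
  exact tendsto_nhds_unique tendsto_const_nhds hc

/-- The volume form of a Ricci-flat ALE metric is Euclidean off the exceptional set. -/
theorem density_pullForm_inverseLift (hm : 2 ≤ m) (hπ : IsResolution Γ π) {η : KahlerForm m X}
    (hALE : IsALE Γ π η) (hRic : η.RicciFlat) {z : EuclideanSpace ℂ (Fin m)} (hz : z ≠ 0) :
    density (pullForm η.form (inverseLift Γ π) z) = 1 := by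
  obtain ⟨i, hi⟩ : ∃ i, z i ≠ 0 := by
    by_contra! h
    exact hz (by ext i; simpa using h i)
  have : Nontrivial (Fin m) := Fin.nontrivial_iff_two_le.mpr hm
  obtain ⟨j, hj⟩ := exists_ne i
  -- Moving in a coordinate direction `j ≠ i` keeps the coordinate `z i ≠ 0`, so the whole line
  -- avoids the origin. This is where `m ≥ 2` is essential.
  set w : EuclideanSpace ℂ (Fin m) := EuclideanSpace.single j 1 with hw
  have hne : ∀ ζ : ℂ, z + ζ • w ≠ 0 := by
    intro ζ h0
    have := congrArg (fun x : EuclideanSpace ℂ (Fin m) => x i) h0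
    simp [hw, hj.symm] at this
    exact hi this
  have hline : Tendsto (fun ζ : ℂ => z + ζ • w) (Bornology.cobounded ℂ)
      (Bornology.cobounded (EuclideanSpace ℂ (Fin m))) := by
    rw [← tendsto_norm_atTop_iff_cobounded]
    refine tendsto_atTop_mono (f := fun ζ : ℂ => ‖ζ‖ - ‖z‖) (fun ζ => ?_)
      (tendsto_atTop_add_const_right _ _ tendsto_norm_cobounded_atTop)
    have h1 : ‖ζ • w‖ = ‖ζ‖ := by rw [norm_smul, hw, PiLp.norm_single]; simp
    have h2 := norm_sub_norm_le (ζ • w) (-z)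
    rw [norm_neg, sub_neg_eq_add, add_comm (ζ • w), h1] at h2
    exact h2
  have hlim := ((Real.continuousAt_log (x := (1 / 2 : ℝ) ^ m) (by positivity)).tendsto.comp
    (tendsto_det_of_isALE hALE)).comp hline
  have h := eq_of_harmonic_of_tendsto
    (fun ζ => harmonicAt_log_det_line hπ η hRic z w (hne ζ)) hlim 0
  have hpos := isPositive_pullForm_inverseLift hπ η hz
  rw [zero_smul, add_zero] at h
  rw [hpos.density_eq, Real.log_injOn_pos hpos.det_pos (show (1 / 2 : ℝ) ^ m ∈ Ioi 0 by
    rw [mem_Ioi]; positivity) h, ← mul_pow]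
  norm_num

theorem volumeForm_eq (hm : 2 ≤ m) (hπ : IsResolution Γ π) {η : KahlerForm m X}
    (hALE : IsALE Γ π η) (hRic : η.RicciFlat) {p : X} (hp : π p ≠ proj Γ 0) {U : Set X}
    {f : X → EuclideanSpace ℂ (Fin m)} (hpU : p ∈ U) (hf : IsLocalLift Γ π U f)
    (v : Fin m × Fin 2 → TangentSpace 𝓘(ℂ, EuclideanSpace ℂ (Fin m)) p) :
    η.volumeForm p v = euclideanVolumeForm m fun a =>
      mfderiv 𝓘(ℂ, EuclideanSpace ℂ (Fin m)) 𝓘(ℂ, EuclideanSpace ℂ (Fin m)) f p (v a) := by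
  have hz : f p ≠ 0 := IsResolution.lift_ne_zero hp (hf.2.2 p hpU)
  have hφp : inverseLift Γ π (f p) = p := hπ.inverseLift_eq hz (hf.2.2 p hpU)
  have h1 := topPower_eq (pullForm η.form (inverseLift Γ π) (f p)) fun a =>
    mfderiv 𝓘(ℂ, EuclideanSpace ℂ (Fin m)) 𝓘(ℂ, EuclideanSpace ℂ (Fin m)) f p (v a)
  rw [density_pullForm_inverseLift hm hπ hALE hRic hz, one_mul] at h1
  rw [← h1]
  have h2 : pullForm η.form (inverseLift Γ π) (f p) =
      (η.form p).compContinuousLinearMap ((mfderiv 𝓘(ℂ, EuclideanSpace ℂ (Fin m))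
        𝓘(ℂ, EuclideanSpace ℂ (Fin m)) (inverseLift Γ π) (f p) :
        EuclideanSpace ℂ (Fin m) →L[ℂ] EuclideanSpace ℂ (Fin m)).restrictScalars ℝ) :=
    compContinuousLinearMap_congr η.form hφp _
  -- Pushing `v` forward by the lift and then by `inverseLift` gives back `v`, so `η` on `v` is the
  -- pulled-back form on the lifted vectors.
  refine Eq.trans ?_ (congrArg (fun θ => topPower m θ _) h2).symm
  refine Eq.trans ?_ (topPower_comp (V := EuclideanSpace ℂ (Fin m))
    (W := EuclideanSpace ℂ (Fin m)) m (η.form p) _ _).symm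
  refine congrArg (topPower m (η.form p)) (funext fun a => ?_)
  exact (mfderiv_inverseLift_comp hπ hp hpU hf (v a)).symm

end Resolution

/-! ### The volume measure -/

section Volume

open Set Filter

lemma measurableSet_inter_preimage_of_continuousOn {α β : Type*} [TopologicalSpace α]
    [MeasurableSpace α] [OpensMeasurableSpace α] [TopologicalSpace β] [MeasurableSpace β]
    [BorelSpace β] {f : α → β} {s : Set α} (hf : ContinuousOn f s) (hs : MeasurableSet s) {t : Set β}
    (ht : MeasurableSet t) : MeasurableSet (s ∩ f ⁻¹' t) := by
  have h := hs.subtype_image (hf.domRestrict.measurable ht)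
  rwa [show s.domRestrict f ⁻¹' t = Subtype.val ⁻¹' (f ⁻¹' t) from rfl, Subtype.image_preimage_coe] at h

/-- Two measures agree on a measurable set if they agree locally. -/
lemma measure_eq_of_locally_eq {α : Type*} [TopologicalSpace α] [SecondCountableTopology α]
    [MeasurableSpace α] [OpensMeasurableSpace α] (μ ν : Measure α) {T : Set α} (hT : MeasurableSet T)
    (h : ∀ p ∈ T, ∃ U, IsOpen U ∧ p ∈ U ∧ ∀ A, MeasurableSet A → A ⊆ U → A ⊆ T → μ A = ν A) :
    μ T = ν T := by
  rcases T.eq_empty_or_nonempty with rfl | hne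
  · simp
  choose! U hUo hpU hU using h
  obtain ⟨s, hsT, hsc, hs⟩ := TopologicalSpace.countable_cover_nhdsWithin (s := T)
    (f := U) fun p hp => nhdsWithin_le_nhds ((hUo p hp).mem_nhds (hpU p hp))
  have hsne : s.Nonempty := by
    obtain ⟨p, hp⟩ := hne
    obtain ⟨q, hq, -⟩ := mem_iUnion₂.mp (hs hp)
    exact ⟨q, hq⟩
  obtain ⟨p, rfl⟩ := hsc.exists_eq_range hsne
  have hpT : ∀ n, p n ∈ T := fun n => hsT (mem_range_self n)
  -- A countable subcover is made disjoint, and countable additivity sums the local equalities.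
  set B : ℕ → Set α := disjointed fun n => U (p n) with hB
  have hBm : ∀ n, MeasurableSet (B n) := fun n =>
    MeasurableSet.disjointed (fun n => (hUo _ (hpT n)).measurableSet) n
  have hcover : T = ⋃ n, T ∩ B n := by
    rw [← inter_iUnion, hB, iUnion_disjointed, eq_comm, inter_eq_left]
    simpa using hs
  have hdisj : Pairwise (Function.onFun Disjoint fun n => T ∩ B n) := fun i j hij =>
    (disjoint_disjointed _ hij).mono inter_subset_right inter_subset_right
  rw [hcover, measure_iUnion hdisj fun n => hT.inter (hBm n),
    measure_iUnion hdisj fun n => hT.inter (hBm n)]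
  exact tsum_congr fun n => hU _ (hpT n) _ (hT.inter (hBm n))
    (inter_subset_right.trans (disjointed_subset _ n)) inter_subset_left

variable {m : ℕ} {X : Type*} [TopologicalSpace X] [ChartedSpace (EuclideanSpace ℂ (Fin m)) X]
  [MeasurableSpace X] [BorelSpace X]

lemma KahlerForm.chartMeasure_apply (η : KahlerForm m X)
    (e : OpenPartialHomeomorph X (EuclideanSpace ℂ (Fin m))) {A : Set X} (hA : MeasurableSet A) :
    η.chartMeasure e A =
      ∫⁻ y in e.target ∩ e.symm ⁻¹' A, ENNReal.ofReal (density (pullForm η.form e.symm y)) := by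
  have h1 : AEMeasurable e.symm
      ((volume : Measure (EuclideanSpace ℂ (Fin m))).restrict e.target) :=
    e.continuousOn_symm.aemeasurable e.open_target.measurableSet
  rw [chartMeasure, Measure.map_apply_of_aemeasurable
    (h1.mono_ac (withDensity_absolutelyContinuous _ _)) hA, withDensity_apply',
    Measure.restrict_restrict' e.open_target.measurableSet, inter_comm]
  rfl

lemma KahlerForm.chartMeasure_inter_source (η : KahlerForm m X)
    (e : OpenPartialHomeomorph X (EuclideanSpace ℂ (Fin m))) {A : Set X} (hA : MeasurableSet A) :
    η.chartMeasure e (A ∩ e.source) = η.chartMeasure e A := by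
  rw [η.chartMeasure_apply e hA, η.chartMeasure_apply e (hA.inter e.open_source.measurableSet)]
  congr 2
  ext y
  simp only [mem_inter_iff, mem_preimage]
  exact ⟨fun h => ⟨h.1, h.2.1⟩, fun h => ⟨h.1, h.2, e.map_target h.1⟩⟩

variable [IsManifold 𝓘(ℂ, EuclideanSpace ℂ (Fin m)) ω X]

omit [MeasurableSpace X] [BorelSpace X] in
/-- Change of variables for the coefficient of the volume form. -/
lemma KahlerForm.setLIntegral_density_eq (η : KahlerForm m X)
    {e : OpenPartialHomeomorph X (EuclideanSpace ℂ (Fin m))}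
    (he : e ∈ atlas (EuclideanSpace ℂ (Fin m)) X) {f : EuclideanSpace ℂ (Fin m) → X}
    {W : Set (EuclideanSpace ℂ (Fin m))} (hW : MeasurableSet W)
    (hf : ∀ z ∈ W, MDifferentiableAt 𝓘(ℂ, EuclideanSpace ℂ (Fin m))
      𝓘(ℂ, EuclideanSpace ℂ (Fin m)) f z) (hfe : MapsTo f W e.source) (hinj : InjOn f W) :
    ∫⁻ z in W, ENNReal.ofReal (density (pullForm η.form f z)) =
      ∫⁻ y in (e ∘ f) '' W, ENNReal.ofReal (density (pullForm η.form e.symm y)) := by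
  rw [lintegral_image_eq_lintegral_abs_det_fderiv_mul volume hW
    (f' := fun z => (fderiv ℂ (e ∘ f) z).restrictScalars ℝ)
    (fun z hz => ((differentiableAt_chart_comp he (hf z hz)
      (hfe hz)).hasFDerivAt.restrictScalars ℝ).hasFDerivWithinAt)
    (fun x hx y hy hxy => hinj hx hy (e.injOn (hfe hx) (hfe hy) hxy))]
  refine setLIntegral_congr_fun hW fun z hz => ?_
  rw [density_pullForm_eq_chart η.form he (hf z hz) (hfe hz), det_restrictScalars_eq,
    abs_of_nonneg (by positivity), ENNReal.ofReal_mul (by positivity)]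
  rfl

/-- Change of variables by the transition map `e ∘ e'.symm`, whose real Jacobian is the factor by
which the densities differ. -/
lemma KahlerForm.chartMeasure_eq_of_subset (η : KahlerForm m X)
    {e e' : OpenPartialHomeomorph X (EuclideanSpace ℂ (Fin m))}
    (he : e ∈ atlas (EuclideanSpace ℂ (Fin m)) X) (he' : e' ∈ atlas (EuclideanSpace ℂ (Fin m)) X)
    {A : Set X} (hA : MeasurableSet A) (hAe : A ⊆ e.source) (hAe' : A ⊆ e'.source) :
    η.chartMeasure e' A = η.chartMeasure e A := by
  rw [η.chartMeasure_apply e hA, η.chartMeasure_apply e' hA, η.setLIntegral_density_eq he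
    (measurableSet_inter_preimage_of_continuousOn e'.continuousOn_symm
      e'.open_target.measurableSet hA)
    (fun z hz => mdifferentiableAt_atlas_symm he' hz.1) (fun z hz => hAe hz.2)
    (fun x hx y hy hxy => e'.symm.injOn hx.1 hy.1 hxy)]
  congr 2
  ext y
  constructor
  · rintro ⟨z, ⟨hz, hzA⟩, rfl⟩
    refine ⟨e.map_source (hAe hzA), ?_⟩
    rw [mem_preimage, Function.comp_apply, e.left_inv (hAe hzA)]
    exact hzA
  · rintro ⟨hy, hyA⟩
    refine ⟨e' (e.symm y), ⟨e'.map_source (hAe' hyA), ?_⟩, ?_⟩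
    · rw [mem_preimage, e'.left_inv (hAe' hyA)]
      exact hyA
    · rw [Function.comp_apply, e'.left_inv (hAe' hyA), e.right_inv hy]

variable [SecondCountableTopology X]

/-- The chart measures are the restrictions of `volumeMeasure`. -/
lemma KahlerForm.volumeMeasure_eq_chartMeasure [Nonempty X] (η : KahlerForm m X)
    {e : OpenPartialHomeomorph X (EuclideanSpace ℂ (Fin m))}
    (he : e ∈ atlas (EuclideanSpace ℂ (Fin m)) X) {A : Set X} (hA : MeasurableSet A)
    (hAe : A ⊆ e.source) : η.volumeMeasure A = η.chartMeasure e A := by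
  obtain ⟨s, hsc, hs⟩ := TopologicalSpace.countable_cover_nhds
    (f := fun x : X => (chartAt (EuclideanSpace ℂ (Fin m)) x).source)
    (fun x => chart_source_mem_nhds _ x)
  have hsne : s.Nonempty := by
    obtain ⟨x⟩ := ‹Nonempty X›
    obtain ⟨q, hq, -⟩ := mem_iUnion₂.mp (hs ▸ mem_univ x)
    exact ⟨q, hq⟩
  obtain ⟨p, rfl⟩ := hsc.exists_eq_range hsne
  set c : ℕ → OpenPartialHomeomorph X (EuclideanSpace ℂ (Fin m)) := fun n => chartAt _ (p n) with hc
  have hca : ∀ n, c n ∈ atlas (EuclideanSpace ℂ (Fin m)) X := fun n => chart_mem_atlas _ _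
  set B : ℕ → Set X := disjointed fun n => (c n).source with hB
  have hBm : ∀ n, MeasurableSet (B n) := fun n =>
    MeasurableSet.disjointed (fun n => (c n).open_source.measurableSet) n
  have hBU : ⋃ n, B n = univ := by
    rw [hB, iUnion_disjointed]
    simpa using hs
  have hdisj : Pairwise (Function.onFun Disjoint B) := disjoint_disjointed _
  -- The measure `ν` patches countably many chart measures along a disjoint partition. It agrees
  -- with every chart measure inside its chart, so it dominates them all and hence their supremum.
  set ν : Measure X := Measure.sum fun n => (η.chartMeasure (c n)).restrict (B n) with hν
  have key : ∀ {e : OpenPartialHomeomorph X (EuclideanSpace ℂ (Fin m))},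
      e ∈ atlas (EuclideanSpace ℂ (Fin m)) X → ∀ {A : Set X}, MeasurableSet A → A ⊆ e.source →
      ν A = η.chartMeasure e A := by
    intro e he A hA hAe
    rw [hν, Measure.sum_apply _ hA]
    have h1 : ∀ n, (η.chartMeasure (c n)).restrict (B n) A = η.chartMeasure e (A ∩ B n) := by
      intro n
      rw [Measure.restrict_apply hA]
      exact η.chartMeasure_eq_of_subset he (hca n) (hA.inter (hBm n))
        (inter_subset_left.trans hAe) (inter_subset_right.trans (disjointed_subset _ n))
    simp only [h1]
    rw [← measure_iUnion (fun i j hij => (hdisj hij).mono inter_subset_right inter_subset_right)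
      fun n => hA.inter (hBm n), ← inter_iUnion, hBU, inter_univ]
  apply le_antisymm
  · rw [← key he hA hAe]
    have : η.volumeMeasure ≤ ν := by
      refine iSup₂_le fun e' he' => Measure.le_iff.mpr fun A' hA' => ?_
      rw [← η.chartMeasure_inter_source e' hA',
        ← key he' (hA'.inter e'.open_source.measurableSet) inter_subset_right]
      exact measure_mono inter_subset_left
    exact this A
  · exact (le_iSup₂ (f := fun e (_ : e ∈ atlas (EuclideanSpace ℂ (Fin m)) X) => η.chartMeasure e)
      e he : η.chartMeasure e ≤ η.volumeMeasure) A

/-- A level set of a non-constant holomorphic function on a connected manifold is a null set. -/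
lemma KahlerForm.volumeMeasure_zeros [ConnectedSpace X] (η : KahlerForm m X) {F : X → ℂ}
    (hF : MDifferentiable 𝓘(ℂ, EuclideanSpace ℂ (Fin m)) 𝓘(ℂ, ℂ) F) {p₀ : X} (hp₀ : F p₀ ≠ 0) :
    η.volumeMeasure (F ⁻¹' {0}) = 0 := by
  have hball : ∀ p : X, ∃ r > 0, Metric.ball (chartAt (EuclideanSpace ℂ (Fin m)) p p) r ⊆
      (chartAt (EuclideanSpace ℂ (Fin m)) p).target := fun p =>
    Metric.isOpen_iff.mp (chartAt _ p).open_target _ (mem_chart_target _ p)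
  choose r hr0 hr using hball
  have hFd : ∀ p, DifferentiableOn ℂ (F ∘ (chartAt (EuclideanSpace ℂ (Fin m)) p).symm)
      (Metric.ball (chartAt (EuclideanSpace ℂ (Fin m)) p p) (r p)) := fun p y hy =>
    ((hF _).comp y (mdifferentiableAt_atlas_symm (chart_mem_atlas _ p)
      (hr p hy))).differentiableAt.differentiableWithinAt
  set N : X → Set X := fun p => (chartAt (EuclideanSpace ℂ (Fin m)) p).source ∩
    chartAt (EuclideanSpace ℂ (Fin m)) p ⁻¹'
      Metric.ball (chartAt (EuclideanSpace ℂ (Fin m)) p p) (r p) with hN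
  have hNo : ∀ p, IsOpen (N p) := fun p =>
    (chartAt _ p).continuousOn.isOpen_inter_preimage (chartAt _ p).open_source Metric.isOpen_ball
  have hpN : ∀ p, p ∈ N p := fun p => ⟨mem_chart_source _ p, Metric.mem_ball_self (hr0 p)⟩
  have hdich : ∀ p, (∀ q ∈ N p, F q = 0) ∨
      volume (Metric.ball (chartAt (EuclideanSpace ℂ (Fin m)) p p) (r p) ∩
        (F ∘ (chartAt (EuclideanSpace ℂ (Fin m)) p).symm) ⁻¹' {0}) = 0 := by
    intro p
    by_cases h : ∀ q ∈ N p, F q = 0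
    · exact Or.inl h
    · push Not at h
      obtain ⟨q, hq, hFq⟩ := h
      refine Or.inr (measure_zeros_ball_eq_zero volume (hFd p) hq.2 ?_)
      rwa [Function.comp_apply, (chartAt _ p).left_inv hq.1]
  -- Identity theorem on the manifold: the set of points near which `F` vanishes is clopen and
  -- misses `p₀`. It is closed because a limit point has an open set of zeros in its chart ball, of
  -- positive measure, which leaves only the first alternative of `hdich`.
  have hzero : ∀ p, ¬ ∀ᶠ q in 𝓝 p, F q = 0 := by
    set Z : Set X := {p | ∀ᶠ q in 𝓝 p, F q = 0} with hZ
    have hZo : IsOpen Z := isOpen_iff_mem_nhds.mpr fun p hp => eventually_eventually_nhds.mpr hp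
    have hZc : IsClosed Z := by
      refine isClosed_of_closure_subset fun p hp => ?_
      have hev : (∀ q ∈ N p, F q = 0) → p ∈ Z := fun h =>
        Filter.mem_of_superset ((hNo p).mem_nhds (hpN p)) h
      rcases hdich p with h | h
      · exact hev h
      · exfalso
        set e := chartAt (EuclideanSpace ℂ (Fin m)) p with he
        obtain ⟨q, hqN, hqZ⟩ := mem_closure_iff.mp hp (N p) (hNo p) (hpN p)
        have hO : IsOpen (e.target ∩ e.symm ⁻¹' (N p ∩ Z)) :=
          e.continuousOn_symm.isOpen_inter_preimage e.open_target ((hNo p).inter hZo)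
        have hne : (e.target ∩ e.symm ⁻¹' (N p ∩ Z)).Nonempty := by
          refine ⟨e q, e.map_source hqN.1, ?_⟩
          rw [mem_preimage, e.left_inv hqN.1]
          exact ⟨hqN, hqZ⟩
        refine (hO.measure_pos volume hne).ne' (measure_mono_null ?_ h)
        rintro y ⟨hy, hyN, hyZ⟩
        refine ⟨?_, hyZ.self_of_nhds⟩
        have := hyN.2
        rwa [mem_preimage, ← he, e.right_inv hy] at this
    rcases isClopen_iff.mp ⟨hZc, hZo⟩ with h | h
    · intro p hp
      exact (h ▸ (show p ∈ Z from hp) : p ∈ (∅ : Set X))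
    · exfalso
      have : p₀ ∈ Z := h ▸ mem_univ p₀
      exact hp₀ this.self_of_nhds
  refine measure_null_of_locally_null _ fun p _ => ?_
  refine ⟨F ⁻¹' {0} ∩ N p, inter_mem self_mem_nhdsWithin
    (nhdsWithin_le_nhds ((hNo p).mem_nhds (hpN p))), ?_⟩
  have hm : MeasurableSet (F ⁻¹' {0} ∩ N p) :=
    (hF.continuous.measurable (measurableSet_singleton 0)).inter (hNo p).measurableSet
  rw [η.volumeMeasure_eq_chartMeasure (chart_mem_atlas _ p) hm
    (inter_subset_right.trans inter_subset_left), η.chartMeasure_apply _ hm]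
  refine setLIntegral_measure_zero _ _ (measure_mono_null ?_ ((hdich p).resolve_left fun h =>
    hzero p (Filter.mem_of_superset ((hNo p).mem_nhds (hpN p)) h)))
  rintro y ⟨hy, hyF, hyN⟩
  refine ⟨?_, hyF⟩
  have := hyN.2
  rwa [mem_preimage, (chartAt _ p).right_inv hy] at this

end Volume

/-! ### The volume of the truncated space -/

section Truncation

open Set Filter

lemma measurePreserving_unitary {m : ℕ} (γ : EuclideanSpace ℂ (Fin m) ≃ₗᵢ[ℂ] EuclideanSpace ℂ (Fin m)) :
    MeasurePreserving γ (volume : Measure (EuclideanSpace ℂ (Fin m))) volume :=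
  LinearIsometryEquiv.measurePreserving
    ({ γ.toLinearEquiv.restrictScalars ℝ with norm_map' := γ.norm_map } :
      EuclideanSpace ℂ (Fin m) ≃ₗᵢ[ℝ] EuclideanSpace ℂ (Fin m))

lemma volume_image_unitary {m : ℕ}
    (γ : EuclideanSpace ℂ (Fin m) ≃ₗᵢ[ℂ] EuclideanSpace ℂ (Fin m))
    (S : Set (EuclideanSpace ℂ (Fin m))) : volume (γ '' S) = volume S := by
  rw [← (measurePreserving_unitary γ).measure_preimage_emb γ.toHomeomorph.measurableEmbedding,
    preimage_image_eq _ γ.injective]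

variable {m : ℕ} {Γ : Subgroup (EuclideanSpace ℂ (Fin m) ≃ₗᵢ[ℂ] EuclideanSpace ℂ (Fin m))}

/-- A non-constant holomorphic function on `ℂ^m / Γ`. -/
lemma exists_holomorphic_on_quotient [Finite Γ] {z₀ : EuclideanSpace ℂ (Fin m)} (hz₀ : z₀ ≠ 0) :
    ∃ g : QuotientSpace Γ → ℂ, Differentiable ℂ (g ∘ proj Γ) ∧ g (proj Γ 0) = 0 ∧
      g (proj Γ z₀) ≠ 0 := by
  have : Fintype Γ := Fintype.ofFinite Γ
  -- A product over the group, hence invariant. It equals `1` at the origin and vanishes at `z₀`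
  -- through the factor of the identity, so `P - 1` separates the two points.
  let P : EuclideanSpace ℂ (Fin m) → ℂ := fun z => ∏ γ : Γ,
    (1 - inner ℂ z₀ (γ.1 z) / (‖z₀‖ ^ 2 : ℝ))
  have hP : ∀ z w, (orbitSetoid Γ).r z w → P z - 1 = P w - 1 := by
    rintro z _ ⟨δ, hδ, rfl⟩
    congr 1
    exact (Fintype.prod_equiv (Equiv.mulRight (⟨δ, hδ⟩ : Γ)) _ _ fun γ => rfl).symm
  refine ⟨Quotient.lift (fun z => P z - 1) hP, ?_, ?_, ?_⟩
  · have h : Differentiable ℂ P := by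
      change Differentiable ℂ fun z => ∏ γ : Γ, (1 - inner ℂ z₀ (γ.1 z) / (‖z₀‖ ^ 2 : ℝ))
      have h1 : ∀ γ : Γ, ContDiff ℂ 1 fun z => inner ℂ z₀ (γ.1 z) := fun γ =>
        (innerSL ℂ z₀).contDiff.comp γ.1.toContinuousLinearEquiv.contDiff
      exact (contDiff_prod fun γ _ => contDiff_const.sub
        ((h1 γ).div_const _)).differentiable one_ne_zero
    exact h.sub_const 1
  · change P 0 - 1 = 0
    simp [P]
  · change P z₀ - 1 ≠ 0
    have : P z₀ = 0 := by
      refine Finset.prod_eq_zero (Finset.mem_univ 1) ?_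
      have h1 : (‖z₀‖ : ℂ) ≠ 0 := by simpa using hz₀
      have h2 : inner ℂ z₀ ((1 : Γ).1 z₀) = (‖z₀‖ : ℂ) ^ 2 := inner_self_eq_norm_sq_to_K z₀
      rw [h2]
      push_cast
      rw [div_self (pow_ne_zero 2 h1), sub_self]
    rw [this]
    norm_num

variable {X : Type*} {π : X → QuotientSpace Γ}

lemma mem_truncation_iff {p : X} {z : EuclideanSpace ℂ (Fin m)} (h : π p = proj Γ z) (R : ℝ) :
    p ∈ truncation Γ π R ↔ ‖z‖ ≤ R := by
  rw [truncation, mem_preimage, h]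
  constructor
  · rintro ⟨w, hw, hwz⟩
    obtain ⟨γ, -, rfl⟩ := proj_eq_proj_iff.mp hwz
    simpa using hw
  · intro hz
    exact ⟨z, by simpa using hz, rfl⟩

variable [TopologicalSpace X] [ChartedSpace (EuclideanSpace ℂ (Fin m)) X]

lemma isClosed_truncation [Nonempty X] (hπ : IsResolution Γ π) (R : ℝ) :
    IsClosed (truncation Γ π R) := by
  refine IsClosed.preimage hπ.proper.continuous ?_
  rw [← isQuotientMap_quotient_mk'.isClosed_preimage]
  have : Quotient.mk' (s := orbitSetoid Γ) ⁻¹' (proj Γ '' Metric.closedBall 0 R) =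
      Metric.closedBall 0 R := by
    ext z
    constructor
    · rintro ⟨w, hw, hwz⟩
      obtain ⟨γ, -, rfl⟩ := proj_eq_proj_iff.mp (hwz : proj Γ w = proj Γ z)
      simpa using hw
    · intro hz
      exact ⟨z, hz, rfl⟩
  rw [this]
  exact Metric.isClosed_closedBall

/-- The preimage of a set in the domain of a local lift `f` is the union of the translates of its
image under `f`. -/
lemma compl_inter_preimage_inverseLift [Nonempty X] (hπ : IsResolution Γ π) {U A : Set X}
    {f : X → EuclideanSpace ℂ (Fin m)} (hf : IsLocalLift Γ π U f) (hAU : A ⊆ U)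
    (hA0 : ∀ p ∈ A, π p ≠ proj Γ 0) :
    {0}ᶜ ∩ inverseLift Γ π ⁻¹' A = ⋃ γ : Γ, γ.1 '' (f '' A) := by
  ext z
  simp only [mem_inter_iff, mem_compl_iff, mem_singleton_iff, mem_preimage, mem_iUnion]
  constructor
  · rintro ⟨hz, hzA⟩
    obtain ⟨γ, hγ, h⟩ := proj_eq_proj_iff.mp
      ((hf.2.2 _ (hAU hzA)).trans (hπ.proj_inverseLift hz))
    exact ⟨⟨γ, hγ⟩, _, ⟨_, hzA, rfl⟩, h⟩
  · rintro ⟨γ, _, ⟨p, hp, rfl⟩, rfl⟩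
    have h1 : proj Γ (γ.1 (f p)) = π p := by
      rw [← hf.2.2 p (hAU hp)]
      exact (proj_eq_proj_iff.mpr ⟨γ.1, γ.2, rfl⟩).symm
    have h0 : γ.1 (f p) ≠ 0 := IsResolution.lift_ne_zero (hA0 p hp) h1
    exact ⟨h0, by rwa [hπ.inverseLift_eq h0 h1]⟩

/-- The preimage consists of the `|Γ|` translates of `f '' A`, all of equal volume. They are
disjoint because `Γ` acts freely and `π` is injective off the exceptional set. -/
lemma volume_compl_inter_preimage [Nonempty X] [Finite Γ] (hΓ : ActsFreely Γ)
    (hπ : IsResolution Γ π) {U A : Set X} {f : X → EuclideanSpace ℂ (Fin m)}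
    (hf : IsLocalLift Γ π U f) (hAU : A ⊆ U) (hA0 : ∀ p ∈ A, π p ≠ proj Γ 0)
    (hfA : MeasurableSet (f '' A)) :
    volume ({0}ᶜ ∩ inverseLift Γ π ⁻¹' A) = Nat.card Γ * volume (f '' A) := by
  have : Fintype Γ := Fintype.ofFinite Γ
  rw [compl_inter_preimage_inverseLift hπ hf hAU hA0, measure_iUnion]
  · simp only [volume_image_unitary]
    rw [tsum_fintype, Finset.sum_const, Finset.card_univ, nsmul_eq_mul, Nat.card_eq_fintype_card]
  · rintro γ δ hγδ
    refine disjoint_left.mpr ?_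
    rintro _ ⟨_, ⟨p, hp, rfl⟩, rfl⟩ ⟨_, ⟨q, hq, rfl⟩, h⟩
    apply hγδ
    have hproj : π q = π p := by
      rw [← hf.2.2 p (hAU hp), ← hf.2.2 q (hAU hq)]
      exact (proj_eq_proj_iff.mpr ⟨δ.1, δ.2, h⟩).trans
        (proj_eq_proj_iff.mpr ⟨γ.1, γ.2, rfl⟩).symm
    obtain rfl : q = p := hπ.bijOn.injOn (hA0 q hq) (hA0 p hp) hproj
    have h0 : f q ≠ 0 := IsResolution.lift_ne_zero (hA0 q hq) (hf.2.2 q (hAU hq))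
    have h1 := hΓ (δ.1⁻¹ * γ.1) (Γ.mul_mem (Γ.inv_mem δ.2) γ.2) (f q) h0 (by
      change δ.1.symm (γ.1 (f q)) = f q
      rw [← h, LinearIsometryEquiv.symm_apply_apply])
    exact Subtype.ext (inv_mul_eq_one.mp h1).symm
  · exact fun γ => γ.1.toHomeomorph.measurableEmbedding.measurableSet_image.mpr hfA

variable [IsManifold 𝓘(ℂ, EuclideanSpace ℂ (Fin m)) ω X] [MeasurableSpace X] [BorelSpace X]
  [SecondCountableTopology X]

/-- The exceptional set lies in the zero set of the pull-back to `X` of a holomorphic function on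
the quotient that vanishes at the origin but not identically. -/
lemma volumeMeasure_exceptional [ConnectedSpace X] [Finite Γ] (hm : 2 ≤ m) (hπ : IsResolution Γ π)
    (η : KahlerForm m X) : η.volumeMeasure {p | π p = proj Γ 0} = 0 := by
  set z₀ : EuclideanSpace ℂ (Fin m) := EuclideanSpace.single ⟨0, by omega⟩ 1 with hz
  have hz₀ : z₀ ≠ 0 := by simp [hz]
  obtain ⟨g, hg, hg0, hgz⟩ := exists_holomorphic_on_quotient (Γ := Γ) hz₀
  have hF := hπ.holomorphic univ g isOpen_univ hg.differentiableOn
  rw [preimage_univ, mdifferentiableOn_univ] at hF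
  refine measure_mono_null ?_ (η.volumeMeasure_zeros hF (p₀ := inverseLift Γ π z₀) ?_)
  · intro p hp
    rw [mem_preimage, Function.comp_apply, (hp : π p = proj Γ 0)]
    exact hg0
  · rwa [Function.comp_apply, hπ.proj_inverseLift hz₀]

/-- Local lifts are volume preserving, in the domain of a chart. -/
lemma volume_image_lift [Nonempty X] (hm : 2 ≤ m) (hπ : IsResolution Γ π) {η : KahlerForm m X}
    (hALE : IsALE Γ π η) (hRic : η.RicciFlat) {U A : Set X} {f : X → EuclideanSpace ℂ (Fin m)}
    (hf : IsLocalLift Γ π U f) {e : OpenPartialHomeomorph X (EuclideanSpace ℂ (Fin m))}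
    (he : e ∈ atlas (EuclideanSpace ℂ (Fin m)) X) (hA : MeasurableSet A) (hAU : A ⊆ U)
    (hAe : A ⊆ e.source) (hA0 : ∀ p ∈ A, π p ≠ proj Γ 0) :
    MeasurableSet (f '' A) ∧ volume (f '' A) = η.volumeMeasure A := by
  set W : Set (EuclideanSpace ℂ (Fin m)) := e.target ∩ e.symm ⁻¹' A with hW
  have hWm : MeasurableSet W := measurableSet_inter_preimage_of_continuousOn e.continuousOn_symm
    e.open_target.measurableSet hA
  have himage : f '' A = (f ∘ e.symm) '' W := by
    ext z
    constructor
    · rintro ⟨p, hp, rfl⟩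
      exact ⟨e p, ⟨e.map_source (hAe hp), by rwa [mem_preimage, e.left_inv (hAe hp)]⟩,
        by rw [Function.comp_apply, e.left_inv (hAe hp)]⟩
    · rintro ⟨y, hy, rfl⟩
      exact ⟨_, hy.2, rfl⟩
  have hdiff : ∀ y ∈ W, DifferentiableAt ℂ (f ∘ e.symm) y := fun y hy =>
    ((mdifferentiableAt_lift (hAU hy.2) hf).comp y
      (mdifferentiableAt_atlas_symm he hy.1)).differentiableAt
  have hder : ∀ y ∈ W, HasFDerivWithinAt (f ∘ e.symm)
      ((fderiv ℂ (f ∘ e.symm) y).restrictScalars ℝ) W y := fun y hy =>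
    ((hdiff y hy).hasFDerivAt.restrictScalars ℝ).hasFDerivWithinAt
  have hinj : InjOn (f ∘ e.symm) W := by
    intro x hx y hy hxy
    have hx0 := IsResolution.lift_ne_zero (hA0 _ hx.2) (hf.2.2 _ (hAU hx.2))
    have hy0 := IsResolution.lift_ne_zero (hA0 _ hy.2) (hf.2.2 _ (hAU hy.2))
    refine e.symm.injOn hx.1 hy.1 ?_
    rw [← hπ.inverseLift_eq hx0 (hf.2.2 _ (hAU hx.2)), ← hπ.inverseLift_eq hy0 (hf.2.2 _ (hAU hy.2))]
    exact congrArg _ hxy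
  rw [himage]
  refine ⟨measurable_image_of_fderivWithin hWm hder hinj, ?_⟩
  rw [← lintegral_abs_det_fderiv_eq_addHaar_image volume hWm hder hinj,
    η.volumeMeasure_eq_chartMeasure he hA hAe, η.chartMeasure_apply e hA]
  refine setLIntegral_congr_fun hWm fun y hy => ?_
  have hy0 := IsResolution.lift_ne_zero (hA0 _ hy.2) (hf.2.2 _ (hAU hy.2))
  -- Through this factorization the density of `η` in the chart is the squared modulus of the
  -- Jacobian of the lift, because `inverseLift` pulls `dμ_η` back with coefficient `1`.
  have hev : e.symm =ᶠ[𝓝 y] inverseLift Γ π ∘ (f ∘ e.symm) := by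
    have h1 := (e.continuousAt_symm hy.1).tendsto.eventually
      (eventually_inverseLift_lift hπ (hA0 _ hy.2) (hAU hy.2) hf)
    exact h1.mono fun x hx => hx.symm
  have h2 : density (pullForm η.form e.symm y) = ‖(fderiv ℂ (f ∘ e.symm) y).det‖ ^ 2 := by
    rw [pullForm_congr η.form hev, pullForm_comp η.form
      (hπ.mdifferentiableAt_inverseLift hy0) (hdiff y hy), density_comp]
    rw [Function.comp_apply, density_pullForm_inverseLift hm hπ hALE hRic hy0, mul_one]
  simp only [h2, det_restrictScalars_eq]
  rw [abs_of_nonneg (by positivity)]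

/-- `inverseLift` is a `|Γ|`-fold covering which respects the volumes. -/
lemma volume_preimage_inverseLift [Nonempty X] [Finite Γ] (hm : 2 ≤ m) (hΓ : ActsFreely Γ)
    (hπ : IsResolution Γ π) {η : KahlerForm m X} (hALE : IsALE Γ π η) (hRic : η.RicciFlat)
    {T : Set X} (hT : MeasurableSet T) (hT0 : ∀ p ∈ T, π p ≠ proj Γ 0) :
    volume ({0}ᶜ ∩ inverseLift Γ π ⁻¹' T) = Nat.card Γ * η.volumeMeasure T := by
  have hae : AEMeasurable (inverseLift Γ π)
      ((volume : Measure (EuclideanSpace ℂ (Fin m))).restrict {0}ᶜ) :=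
    (continuousOn_inverseLift hπ).aemeasurable isOpen_compl_singleton.measurableSet
  have hmap : ∀ A, MeasurableSet A → (((volume : Measure (EuclideanSpace ℂ (Fin m))).restrict
      {0}ᶜ).map (inverseLift Γ π)) A = volume ({0}ᶜ ∩ inverseLift Γ π ⁻¹' A) := by
    intro A hA
    rw [Measure.map_apply_of_aemeasurable hae hA,
      Measure.restrict_apply' isOpen_compl_singleton.measurableSet, inter_comm]
  have h := measure_eq_of_locally_eq (((volume : Measure (EuclideanSpace ℂ (Fin m))).restrict
      {0}ᶜ).map (inverseLift Γ π)) ((Nat.card Γ : ENNReal) • η.volumeMeasure) hT fun p hp => by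
    obtain ⟨U, f, hpU, hf⟩ := hπ.exists_lift p (hT0 p hp)
    refine ⟨U ∩ (chartAt (EuclideanSpace ℂ (Fin m)) p).source,
      hf.1.inter (chartAt _ p).open_source, ⟨hpU, mem_chart_source _ p⟩, fun A hA hAU hAT => ?_⟩
    obtain ⟨h1, h2⟩ := volume_image_lift hm hπ hALE hRic hf (chart_mem_atlas _ p) hA
      (hAU.trans inter_subset_left) (hAU.trans inter_subset_right) fun q hq => hT0 q (hAT hq)
    rw [hmap A hA, volume_compl_inter_preimage hΓ hπ hf (hAU.trans inter_subset_left)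
      (fun q hq => hT0 q (hAT hq)) h1, h2]
    rfl
  rw [hmap T hT] at h
  exact h

/-- Null sets are dropped on both sides, the exceptional set in `X` and the origin in `ℂ^m`. What
remains on the right is the preimage under `inverseLift` of what remains on the left. -/
theorem card_mul_volumeMeasure_truncation [ConnectedSpace X] [Finite Γ] (hm : 2 ≤ m)
    (hΓ : ActsFreely Γ) (hπ : IsResolution Γ π) {η : KahlerForm m X} (hALE : IsALE Γ π η)
    (hRic : η.RicciFlat) (R : ℝ) :
    Nat.card Γ * η.volumeMeasure (truncation Γ π R) =
      volume (Metric.closedBall (0 : EuclideanSpace ℂ (Fin m)) R) := by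
  have hE := volumeMeasure_exceptional hm hπ η
  rw [← measure_sdiff_null hE,
    show truncation Γ π R \ {p | π p = proj Γ 0} = truncation Γ π R ∩ {p | π p ≠ proj Γ 0} from rfl,
    ← volume_preimage_inverseLift hm hΓ hπ hALE hRic
    ((isClosed_truncation hπ R).measurableSet.inter (isOpen_ne_zero hπ).measurableSet)
    fun p hp => hp.2]
  have : Nontrivial (EuclideanSpace ℂ (Fin m)) :=
    ⟨⟨EuclideanSpace.single ⟨0, by omega⟩ 1, 0, by simp⟩⟩
  rw [← measure_sdiff_null (s := Metric.closedBall (0 : EuclideanSpace ℂ (Fin m)) R)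
    (measure_singleton 0)]
  congr 1
  ext z
  simp only [mem_inter_iff, mem_compl_iff, mem_singleton_iff, mem_preimage, Set.mem_sdiff,
    mem_closedBall_zero_iff]
  constructor
  · rintro ⟨hz, h, -⟩
    exact ⟨(mem_truncation_iff (hπ.proj_inverseLift hz) R).mp h, hz⟩
  · rintro ⟨h, hz⟩
    refine ⟨hz, (mem_truncation_iff (hπ.proj_inverseLift hz) R).mpr h, ?_⟩
    change ¬ π _ = _
    rw [hπ.proj_inverseLift hz]
    exact fun h0 => hz (proj_eq_zero_iff.mp h0)

end Truncation

end ALEKahler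

end

theorem lemma2p5 {m : ℕ} (hm : 2 ≤ m)
    (Γ : Subgroup (EuclideanSpace ℂ (Fin m) ≃ₗᵢ[ℂ] EuclideanSpace ℂ (Fin m)))
    [Finite Γ] (hΓ : ALEKahler.ActsFreely Γ)
    {X : Type*} [TopologicalSpace X] [T2Space X] [SecondCountableTopology X] [ConnectedSpace X]
    [ChartedSpace (EuclideanSpace ℂ (Fin m)) X]
    [IsManifold 𝓘(ℂ, EuclideanSpace ℂ (Fin m)) ω X]
    [MeasurableSpace X] [BorelSpace X]
    (η : ALEKahler.KahlerForm m X) (π : X → ALEKahler.QuotientSpace Γ)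
    (hπ : ALEKahler.IsResolution Γ π) (hALE : ALEKahler.IsALE Γ π η) (hRic : η.RicciFlat) :
    (∀ p : X, π p ≠ ALEKahler.proj Γ 0 →
      ∀ (U : Set X) (f : X → EuclideanSpace ℂ (Fin m)), p ∈ U → ALEKahler.IsLocalLift Γ π U f →
        ∀ v : Fin m × Fin 2 → TangentSpace 𝓘(ℂ, EuclideanSpace ℂ (Fin m)) p,
          η.volumeForm p v = ALEKahler.euclideanVolumeForm m fun a =>
            mfderiv 𝓘(ℂ, EuclideanSpace ℂ (Fin m)) 𝓘(ℂ, EuclideanSpace ℂ (Fin m)) f p (v a)) ∧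
    (∀ R : ℝ, 0 < R →
      η.volumeMeasure (ALEKahler.truncation Γ π R) =
        ENNReal.ofReal
          (((volume : Measure (EuclideanSpace ℂ (Fin m))).toSphere Set.univ).toReal
            / (2 * m * Nat.card Γ) * R ^ (2 * m))) := by
  refine ⟨fun p hp U f hpU hf v => ALEKahler.volumeForm_eq hm hπ hALE hRic hp hpU hf v,
    fun R hR => ?_⟩
  have h := ALEKahler.card_mul_volumeMeasure_truncation hm hΓ hπ hALE hRic R
  have hdim : Module.finrank ℝ (EuclideanSpace ℂ (Fin m)) = 2 * m := by
    rw [Module.finrank_eq_card_basis (ALEKahler.realBasis m)]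
    simp [mul_comm]
  have hcard : (0 : ℝ) < Nat.card Γ := Nat.cast_pos.mpr Nat.card_pos
  have hm0 : (0 : ℝ) < m := Nat.cast_pos.mpr (by omega)
  set b := volume (Metric.ball (0 : EuclideanSpace ℂ (Fin m)) 1) with hb
  have hbtop : b ≠ ⊤ := measure_ball_lt_top.ne
  rw [Measure.addHaar_closedBall _ _ hR.le, hdim, ← hb] at h
  -- The area of the unit sphere is `2m` times the volume of the unit ball, which accounts for the
  -- `2m` in the denominator.
  rw [Measure.toSphere_apply_univ, hdim, ← hb, ENNReal.toReal_mul, ENNReal.toReal_natCast]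
  have hc0 : (Nat.card Γ : ENNReal) ≠ 0 := by exact_mod_cast Nat.card_pos.ne'
  rw [← ENNReal.mul_right_inj hc0 (ENNReal.natCast_ne_top _), h, ← ENNReal.ofReal_natCast,
    ← ENNReal.ofReal_mul hcard.le, ← ENNReal.ofReal_toReal hbtop,
    ← ENNReal.ofReal_mul (by positivity), ENNReal.toReal_ofReal ENNReal.toReal_nonneg]
  congr 1
  push_cast
  field_simp
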